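/- **Setting.** Let $\Omega\subset\mathbb R^d$ be compact and convex. For probability measures $\mu,\nu$ on $\mathbb R^d$ let $\mathrm W(\mu,\nu)=\inf_\pi\big(\int|x-y|^2\,d\pi(x,y)\big)^{1/2}$, the infimum over all couplings $\pi$ of $\mu$ and $\nu$, be the Wasserstein-2 distance. For a curve $\rho$ of probability measures on $\Omega$, $t\in[0,1]$, that is Lipschitz for $\mathrm W$, let $\mathrm{CE}(\rho)$ be the set of measurable families of fields $v(t)\in L^2(\rho(t);\mathbb R^d)$ with $$\int_0^1\!\!\int\partial_t\phi\,d\rho(t)\,dt+\int_0^1\!\!\int\langle\nabla\phi(t,\cdot),v(t)\rangle\,d\rho(t)\,dt=\int\phi(1,\cdot)\,d\rho(1)-\int\phi(0,\cdot)\,d\rho(0)$$ for all $C^1$ functions $\phi(t,x)$, and let $\mathrm{energy}(\rho)=\inf_{v\in \mathrm{CE}(\rho)}\int_0^1\|v(t)\|^2_{L^2(\rho(t))}\,dt$. For a set $\Lambda$ of probability measures on $\Omega$ and $\mu,\nu\in\Lambda$ let $$\mathrm W_\Lambda(\mu,\nu)=\inf\{\mathrm{energy}(\rho)^{1/2} :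 \rho\in\mathrm{Lip}([0,1];(\Lambda,\mathrm W)),\ \rho(0)=\mu,\ \rho(1)=\nu\}.$$ **Assumptions.** (i) *Parameter manifold.* $\mathcal S$ is a compact connected finite-dimensional smooth Riemannian manifold; it may have a boundary, in which case it is a geodesically convex subset of a larger smooth Riemannian manifold without boundary. Denote by $d_{\mathcal S}$ the induced distance (infimum of the lengths of paths in $\mathcal S$). $\mathcal D$ is a set of tangent vectors $(\theta,\eta)$ at points $\theta \in \mathcal S$ on which the exponential map is well-defined, such that $(\theta,\eta)\in\mathcal D$ implies $(\theta,t\eta)\in\mathcal D$ for $t\in[0,1]$, and such that for $(\theta,\eta)\in\mathcal D$ the curve $\gamma(t)=\exp_\theta(t\eta)$, $t\in[0,1]$, is a constant speed geodesic in $\mathcal S$ with $\|\dot\gamma(t)\|_{\gamma(t)}=\|\eta\|_\theta=d_{\mathcal S}(\theta,\exp_\theta(\eta))$. For all $\theta_0,\theta_1\in\mathcal S$ there is $\eta$ with $(\theta_0,\eta)\in\mathcal D$ and $\exp_{\theta_0}(\eta)=\theta_1$. Write $\mathcal D_\theta=\{\eta:(\theta,\eta)\in\mathcal D\}$. (ii)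 *Embedding.* $E:\mathcal S\to\mathcal P(\Omega)$, $\theta\mapsto\lambda_\theta$, is bi-Lipschitz for $d_{\mathcal S}$ and $\mathrm W$ onto its image $\Lambda=E(\mathcal S)$, and every $\lambda_\theta$ is absolutely continuous with respect to the Lebesgue measure. (iii) *Velocity fields.* For each $\theta\in\mathcal S$, $B_\theta$ is a linear map from $T_\theta\mathcal S$ to the $C^1$ gradient vector fields on $\mathbb R^d$, and there is $C_0\in(0,\infty)$ such that for all $(\theta,\eta)\in\mathcal D$, $x\in\mathbb R^d$, $t\in[0,1]$, with $\gamma(t)=\exp_\theta(t\eta)$, $$\tfrac1{C_0}\|\eta\|_\theta\le\|B_\theta\eta\|_{L^2(\lambda_\theta)}\le C_0\|\eta\|_\theta,\qquad \|B_\theta\eta\|_{C^1(\mathbb R^d)}\le C_0\|\eta\|_\theta,\qquad \big|\partial_t[B_{\gamma(t)}\dot\gamma(t)](x)\big|\le C_0\|\eta\|_\theta^2 .$$ (iv) *Consistency.* For every Lipschitz curve $\gamma:[0,1]\to(\mathcal S,d_{\mathcal S})$, the flow $\varphi$ on $[0,1]\times\Omega$ given by $\varphi(0,\cdot)=\mathrm{id}$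 and $\partial_t\varphi(t,\cdot)=[B_{\gamma(t)}\dot\gamma(t)](\varphi(t,\cdot))$ for a.e. $t$ satisfies $\lambda_{\gamma(t)}=\varphi(t,\cdot)_\#\lambda_{\gamma(0)}$ for all $t\in[0,1]$. **Theorem.** There is a constant $C\in(0,\infty)$ such that for every $\theta\in\mathcal S$ and all $\eta_1,\eta_2\in\mathcal D_\theta$, with $\gamma_i(t)=\exp_\theta(t\eta_i)$, $t\in[0,1]$, the distance $\mathrm W_\Lambda(\lambda_{\gamma_1(t)},\lambda_{\gamma_2(t)})$ is finite and $$\Big|\mathrm W_\Lambda(\lambda_{\gamma_1(t)},\lambda_{\gamma_2(t)})-t\,\|B_\theta(\eta_1-\eta_2)\|_{L^2(\lambda_\theta)}\Big|\le C\,t^2\,(\|\eta_1\|_\theta+\|\eta_2\|_\theta)^2$$ for all $t\in\big[0,\min\{1,\tfrac1{C\|\eta_1\|_\theta},\tfrac1{C\|\eta_2\|_\theta}\}\big)$ (with $\tfrac10=\infty$). Moreover, the (one-sided) derivative at $t=0$ exists and $$\frac{d}{dt}\,\mathrm W_\Lambda(\lambda_{\gamma_1(t)},\lambda_{\gamma_2(t)})\Big|_{t=0}=\|B_\theta(\eta_1-\eta_2)\|_{L^2(\lambda_\theta)}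 .$$ -/

import Mathlib

open Set MeasureTheory Manifold Bundle
open scoped ContDiff ENNReal NNReal Topology

noncomputable section

namespace WassersteinSubmanifold

/-- Euclidean space of dimension `n`. -/
abbrev Eucl (n : ℕ) : Type := EuclideanSpace ℝ (Fin n)

/-! ### Wasserstein distance, energy of curves, geodesic restriction -/

section Wasserstein

variable {d : ℕ}

/-- The Wasserstein-2 distance, as an extended number: the square root of the infimum of
`∫ |x - y|² dκ` over all measures `κ` with first marginal `μ` and second marginal `ν`. -/
def wassEDist (μ ν : Measure (Eucl d)) : ℝ≥0∞ :=
  (⨅ (κ : Measure (Eucl d × Eucl d)) (_ : κ.map Prod.fst = μ) (_ : κ.map Prod.snd = ν),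
    ∫⁻ p, ‖p.1 - p.2‖ₑ ^ 2 ∂κ) ^ (1 / 2 : ℝ)

/-- `v ∈ CE(ρ)`: the velocity fields `v t ∈ L²(ρ t)` are (jointly) measurable and satisfy the
continuity equation with `ρ` on `[0,1]`, tested against all `C¹` functions of `(t, x)`. -/
structure IsContinuityEq (ρ : ℝ → Measure (Eucl d)) (v : ℝ → Eucl d → Eucl d) : Prop where
  measurable : Measurable (fun p : ℝ × Eucl d => v p.1 p.2)
  memLp : ∀ t ∈ Icc (0 : ℝ) 1, MemLp (v t) 2 (ρ t)
  eq : ∀ φ : ℝ × Eucl d → ℝ, ContDiff ℝ 1 φ →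
    (∫ t in (0 : ℝ)..1, ∫ x, deriv (fun s => φ (s, x)) t ∂(ρ t)) +
      (∫ t in (0 : ℝ)..1, ∫ x, inner ℝ (gradient (fun y => φ (t, y)) x) (v t x) ∂(ρ t)) =
    (∫ x, φ (1, x) ∂(ρ 1)) - ∫ x, φ (0, x) ∂(ρ 0)

/-- `energy(ρ)`: the infimum of `∫₀¹ ‖v t‖²_{L²(ρ t)} dt` over `v ∈ CE(ρ)`. -/
def energy (ρ : ℝ → Measure (Eucl d)) : ℝ≥0∞ :=
  ⨅ (v : ℝ → Eucl d → Eucl d) (_ : IsContinuityEq ρ v),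
    ∫⁻ t in Icc (0 : ℝ) 1, ∫⁻ x, ‖v t x‖ₑ ^ 2 ∂(ρ t)

/-- `ρ ∈ Lip([0,1]; (Λ, W))`. -/
def IsLipCurveIn (L : Set (Measure (Eucl d))) (ρ : ℝ → Measure (Eucl d)) : Prop :=
  (∀ t ∈ Icc (0 : ℝ) 1, ρ t ∈ L) ∧
    ∃ K : ℝ≥0, ∀ s ∈ Icc (0 : ℝ) 1, ∀ t ∈ Icc (0 : ℝ) 1,
      wassEDist (ρ s) (ρ t) ≤ K * edist s t

/-- The geodesic restriction `W_Λ` of the Wasserstein distance to a set `L` of measures. -/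
def geodRestrEDist (L : Set (Measure (Eucl d))) (μ ν : Measure (Eucl d)) : ℝ≥0∞ :=
  ⨅ (ρ : ℝ → Measure (Eucl d)) (_ : IsLipCurveIn L ρ) (_ : ρ 0 = μ) (_ : ρ 1 = ν),
    energy ρ ^ (1 / 2 : ℝ)

end Wasserstein

/-! ### Riemannian geometry: velocities, intrinsic distance, geodesics, exponential map -/

section Riemannian

variable {F : Type*} [NormedAddCommGroup F] [NormedSpace ℝ F]
  {M : Type*} [TopologicalSpace M] [ChartedSpace F M]

/-- The velocity `γ̇(t)` of a curve on `[0,1]` (one-sided at the endpoints). -/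
def velocity (F : Type*) [NormedAddCommGroup F] [NormedSpace ℝ F]
    {M : Type*} [TopologicalSpace M] [ChartedSpace F M]
    (γ : ℝ → M) (t : ℝ) : TangentSpace 𝓘(ℝ, F) (γ t) :=
  mfderivWithin 𝓘(ℝ, ℝ) 𝓘(ℝ, F) γ (Icc 0 1) t (1 : ℝ)

variable [RiemannianBundle (fun x : M => TangentSpace 𝓘(ℝ, F) x)]

/-- The distance `d_S` induced on `S ⊆ M` by the Riemannian metric: the infimum of the lengths of
the `C¹` paths contained in `S`. -/
def intrinsicEDist (F : Type*) [NormedAddCommGroup F] [NormedSpace ℝ F]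
    {M : Type*} [TopologicalSpace M] [ChartedSpace F M]
    [RiemannianBundle (fun x : M => TangentSpace 𝓘(ℝ, F) x)] (S : Set M) (x y : M) : ℝ≥0∞ :=
  ⨅ (γ : ℝ → M) (_ : ContMDiffOn 𝓘(ℝ, ℝ) 𝓘(ℝ, F) 1 γ (Icc 0 1)) (_ : MapsTo γ (Icc 0 1) S)
    (_ : γ 0 = x) (_ : γ 1 = y), pathELength 𝓘(ℝ, F) γ 0 1

/-- The coordinate expression at `y`, in the chart at `p`, of the Riemannian metric:
`(a, b) ↦ ∑ g_{ij}(y) a^i b^j`. -/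
def chartMetric (p : M) (y a b : F) : ℝ :=
  inner ℝ (mfderiv 𝓘(ℝ, F) 𝓘(ℝ, F) (extChartAt 𝓘(ℝ, F) p).symm y a)
    (mfderiv 𝓘(ℝ, F) 𝓘(ℝ, F) (extChartAt 𝓘(ℝ, F) p).symm y b)

/-- `γ : [0,1] → M` is a geodesic: it is smooth and, in every chart, its coordinates `x(t)` solve
`ẍ^k + Γ^k_{ij}(x) ẋ^i ẋ^j = 0`. The equation is written with the upper index lowered, that is,
paired through the metric with an arbitrary coordinate vector `w`; the Christoffel symbols then
contribute `(∂_ẋ g)(ẋ, w) - ½ (∂_w g)(ẋ, ẋ)`. -/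
structure IsGeodesic (γ : ℝ → M) : Prop where
  smooth : ContMDiffOn 𝓘(ℝ, ℝ) 𝓘(ℝ, F) ∞ γ (Icc 0 1)
  equation : ∀ t ∈ Icc (0 : ℝ) 1, ∀ p : M, γ t ∈ (chartAt F p).source → ∀ w : F,
    let x : ℝ → F := fun s => extChartAt 𝓘(ℝ, F) p (γ s)
    let x' : F := derivWithin x (Icc 0 1) t
    let x'' : F := iteratedDerivWithin 2 x (Icc 0 1) t
    chartMetric p (x t) x'' w + fderiv ℝ (fun y => chartMetric p y x' w) (x t) x'
      - (1 / 2) * fderiv ℝ (fun y => chartMetric p y x' x') (x t) w = 0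

/-- `γ : [0,1] → M` is a geodesic with `γ(0) = θ` and `γ̇(0) = η`. -/
def IsGeodesicFrom (θ : M) (η : TangentSpace 𝓘(ℝ, F) θ) (γ : ℝ → M) : Prop :=
  IsGeodesic (F := F) γ ∧
    (⟨γ 0, velocity F γ 0⟩ : TangentBundle 𝓘(ℝ, F) M) = ⟨θ, η⟩

open Classical in
/-- The Riemannian exponential map: `exp_θ(η) = γ(1)` for the geodesic `γ` on `[0,1]` with
`γ(0) = θ` and `γ̇(0) = η` (with the value `θ` where there is no such geodesic). -/
def riemExp (θ : M) (η : TangentSpace 𝓘(ℝ, F) θ) : M :=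
  if h : ∃ γ : ℝ → M, IsGeodesicFrom θ η γ then h.choose 1 else θ

/-- The curve `t ↦ exp_θ(t η)`. -/
def expCurve (θ : M) (η : TangentSpace 𝓘(ℝ, F) θ) (t : ℝ) : M := riemExp θ (t • η)

/-- `γ ∈ Lip([0,1]; (S, d_S))`. -/
def IsLipCurveOn (F : Type*) [NormedAddCommGroup F] [NormedSpace ℝ F]
    {M : Type*} [TopologicalSpace M] [ChartedSpace F M]
    [RiemannianBundle (fun x : M => TangentSpace 𝓘(ℝ, F) x)] (S : Set M) (γ : ℝ → M) : Prop :=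
  MapsTo γ (Icc 0 1) S ∧
    ∃ K : ℝ≥0, ∀ s ∈ Icc (0 : ℝ) 1, ∀ t ∈ Icc (0 : ℝ) 1,
      intrinsicEDist F S (γ s) (γ t) ≤ K * edist s t

end Riemannian

/-! ### Parametrized submanifolds of Wasserstein space -/

section Main

variable {d : ℕ} {F : Type*} [NormedAddCommGroup F] [NormedSpace ℝ F]
  {M : Type*} [TopologicalSpace M] [ChartedSpace F M]
  [RiemannianBundle (fun x : M => TangentSpace 𝓘(ℝ, F) x)]

/-- `φ : [0,1] × Ω → ℝᵈ` is a flow of the time dependent field `v`: each `φ(·, x)` is absolutely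
continuous, `φ(0, ·) = id`, and `∂ₜ φ(t, ·) = v(t, φ(t, ·))` for a.e. `t`; the maps `φ(t, ·)` are
measurable with respect to `μ`, so that the push-forward of `μ` makes sense. -/
structure IsFlow (Ω : Set (Eucl d)) (μ : Measure (Eucl d)) (v : ℝ → Eucl d → Eucl d)
    (φ : ℝ → Eucl d → Eucl d) : Prop where
  init : ∀ x ∈ Ω, φ 0 x = x
  absCont : ∀ x ∈ Ω, AbsolutelyContinuousOnInterval (fun t => φ t x) 0 1
  ode : ∀ᵐ t ∂(volume.restrict (Icc (0 : ℝ) 1)), ∀ x ∈ Ω,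
    HasDerivWithinAt (fun s => φ s x) (v t (φ t x)) (Icc 0 1) t
  aemeasurable : ∀ t ∈ Icc (0 : ℝ) 1, AEMeasurable (φ t) μ

/-- The parameter manifold. `S` is a compact connected subset of a Riemannian manifold `M`
without boundary (`S = M` if the parameter manifold has no boundary; otherwise `S` is a
geodesically convex subset of the larger manifold `M`), and `D` is a set of tangent vectors
`(θ, η)`, star-shaped in `η`, on which the exponential map is well-defined and such that
`t ↦ exp_θ(t η)` is a constant speed geodesic in `S` of length `‖η‖ = d_S(θ, exp_θ(η))`; any two
points of `S` are joined by one of these geodesics. -/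
structure IsParameterManifold (S : Set M) (D : Set (TangentBundle 𝓘(ℝ, F) M)) : Prop where
  isCompact : IsCompact S
  isConnected : IsConnected S
  base_mem : ∀ (θ : M) (η : TangentSpace 𝓘(ℝ, F) θ),
    (⟨θ, η⟩ : TangentBundle 𝓘(ℝ, F) M) ∈ D → θ ∈ S
  smul_mem : ∀ (θ : M) (η : TangentSpace 𝓘(ℝ, F) θ),
    (⟨θ, η⟩ : TangentBundle 𝓘(ℝ, F) M) ∈ D → ∀ t ∈ Icc (0 : ℝ) 1,
      (⟨θ, t • η⟩ : TangentBundle 𝓘(ℝ, F) M) ∈ D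
  geodesic : ∀ (θ : M) (η : TangentSpace 𝓘(ℝ, F) θ),
    (⟨θ, η⟩ : TangentBundle 𝓘(ℝ, F) M) ∈ D → IsGeodesicFrom θ η (expCurve θ η)
  mapsTo : ∀ (θ : M) (η : TangentSpace 𝓘(ℝ, F) θ),
    (⟨θ, η⟩ : TangentBundle 𝓘(ℝ, F) M) ∈ D → MapsTo (expCurve θ η) (Icc 0 1) S
  speed : ∀ (θ : M) (η : TangentSpace 𝓘(ℝ, F) θ),
    (⟨θ, η⟩ : TangentBundle 𝓘(ℝ, F) M) ∈ D → ∀ t ∈ Icc (0 : ℝ) 1,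
      ‖velocity F (expCurve θ η) t‖ = ‖η‖
  minimizing : ∀ (θ : M) (η : TangentSpace 𝓘(ℝ, F) θ),
    (⟨θ, η⟩ : TangentBundle 𝓘(ℝ, F) M) ∈ D → ‖η‖ₑ = intrinsicEDist F S θ (riemExp θ η)
  exists_exp_eq : ∀ θ₀ ∈ S, ∀ θ₁ ∈ S, ∃ η : TangentSpace 𝓘(ℝ, F) θ₀,
    (⟨θ₀, η⟩ : TangentBundle 𝓘(ℝ, F) M) ∈ D ∧ riemExp θ₀ η = θ₁

/-- The embedding `E : S → P(Ω)`: a bi-Lipschitz map, from `d_S` to the Wasserstein distance, into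
the absolutely continuous probability measures on `Ω`. (Values of `E` off `S` play no role.) -/
structure IsEmbeddingOn (Ω : Set (Eucl d)) (S : Set M) (E : M → Measure (Eucl d)) : Prop where
  isProbabilityMeasure : ∀ θ ∈ S, IsProbabilityMeasure (E θ)
  concentrated : ∀ θ ∈ S, E θ Ωᶜ = 0
  absolutelyContinuous : ∀ θ ∈ S, E θ ≪ volume
  biLipschitz : ∃ L : ℝ≥0, ∀ θ₀ ∈ S, ∀ θ₁ ∈ S,
    wassEDist (E θ₀) (E θ₁) ≤ L * intrinsicEDist F S θ₀ θ₁ ∧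
    intrinsicEDist F S θ₀ θ₁ ≤ L * wassEDist (E θ₀) (E θ₁)

/-- The velocity fields: linear maps `B_θ` from the tangent space at `θ` to `C¹` gradient vector
fields on `ℝᵈ`, with the uniform bounds
`‖B_θ η‖_{L²(λ_θ)} ∈ [1/C, C] ‖η‖`, `‖B_θ η‖_{C¹} ≤ C ‖η‖` and
`|∂ₜ [B_{γ(t)} γ̇(t)](x)| ≤ C ‖η‖²`, `γ(t) = exp_θ(t η)`, for `(θ, η) ∈ D`. -/
structure IsVelocityFamily (S : Set M) (D : Set (TangentBundle 𝓘(ℝ, F) M))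
    (E : M → Measure (Eucl d))
    (B : ∀ θ : M, TangentSpace 𝓘(ℝ, F) θ →ₗ[ℝ] (Eucl d → Eucl d)) : Prop where
  contDiff : ∀ θ ∈ S, ∀ η : TangentSpace 𝓘(ℝ, F) θ, ContDiff ℝ 1 (B θ η)
  isGradient : ∀ θ ∈ S, ∀ η : TangentSpace 𝓘(ℝ, F) θ, ∃ ψ : Eucl d → ℝ,
    ∀ x, HasGradientAt ψ (B θ η x) x
  bounds : ∃ C : ℝ, 0 < C ∧ ∀ (θ : M) (η : TangentSpace 𝓘(ℝ, F) θ),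
    (⟨θ, η⟩ : TangentBundle 𝓘(ℝ, F) M) ∈ D →
      (1 / C * ‖η‖ ≤ lpNorm (B θ η) 2 (E θ) ∧ lpNorm (B θ η) 2 (E θ) ≤ C * ‖η‖) ∧
      (∀ x, ‖B θ η x‖ ≤ C * ‖η‖ ∧ ‖fderiv ℝ (B θ η) x‖ ≤ C * ‖η‖) ∧
      (∀ x, ∀ t ∈ Icc (0 : ℝ) 1, ∃ a : Eucl d,
        HasDerivWithinAt
          (fun s => B (expCurve θ η s) (velocity F (expCurve θ η) s) x) a (Icc 0 1) t ∧
        ‖a‖ ≤ C * ‖η‖ ^ 2)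

/-- Consistency of the velocity fields with the embedding: for every Lipschitz curve `γ` in `S`,
the flow `φ` of `v(t, ·) = B_{γ(t)} γ̇(t)` satisfies `λ_{γ(t)} = φ(t, ·)_# λ_{γ(0)}`. -/
def IsConsistent (Ω : Set (Eucl d)) (S : Set M) (E : M → Measure (Eucl d))
    (B : ∀ θ : M, TangentSpace 𝓘(ℝ, F) θ →ₗ[ℝ] (Eucl d → Eucl d)) : Prop :=
  ∀ γ : ℝ → M, IsLipCurveOn F S γ → ∀ φ : ℝ → Eucl d → Eucl d,
    IsFlow Ω (E (γ 0)) (fun t => B (γ t) (velocity F γ t)) φ →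
      ∀ t ∈ Icc (0 : ℝ) 1, E (γ t) = (E (γ 0)).map (φ t)

end Main

end WassersteinSubmanifold

end

/-! Write λ for the embedded measures. The statement reduces to an estimate without t: for η₁, η₂ in
D at θ, the distance W_Λ between λ at exp η₁ and λ at exp η₂ equals ‖B_θ(η₁ - η₂)‖ up to O((‖η₁‖ +
‖η₂‖)²). Applying it to tη₁, tη₂, which stay in D, gives the theorem.

One geodesic (`exists_abs_geodRestrEDist_exp_sub_le`). The flow of B_{γ(t)}γ̇(t) along γ(t) =
exp_θ(tη) transports λ_θ, and its time-one map is id + B_θη + O(‖η‖²). For the upper bound, the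
curve λ_{γ(t)} with this field solves the continuity equation, and its speed is ‖B_θη‖ + O(‖η‖²).
For the lower bound let B_θη = ∇ψ. Testing the continuity equation of an arbitrary competitor with ψ
- (κ/2)t|∇ψ|², a subsolution of the Hamilton–Jacobi equation, bounds its energy below by a dual
value (`ofReal_dual_le_kinetic`), which is ‖B_θη‖² - O(‖η‖³) (`dual_value_ge`). The lower bound on
‖B_θη‖ in terms of ‖η‖ turns this into ‖B_θη‖ - O(‖η‖²) after taking the root.

Two geodesics (`lpNorm_triangle_defect_le`). Join exp η₁ to exp η₂ by a geodesic with initial vector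
ζ; bi-Lipschitzness gives ‖ζ‖ = O(‖η₁‖ + ‖η₂‖), and the first part gives the distance as the norm of
Bζ. The transport map T₂ of η₂ and the composition T₃ ∘ T₁ of those of ζ and η₁ push λ_θ to the same
measure, though they may differ as maps. Their difference is w = Bη₂ - Bη₁ - Bζ up to second order.
Since w = ∇u is a gradient and u has the same integral along both maps, expanding u gives ‖w‖² ≲
‖w‖·O(τ²) + O(τ⁴) with τ = ‖η₁‖ + ‖η₂‖, so w is O(τ²) in L² (`lpNorm_gradient_le_of_map_eq`).

The flow needs care. The spatial Lipschitz bound is available only for vectors in D, and (γ(t),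
γ̇(t)) is not assumed to lie in D for t > 0. Solutions are therefore built by Peano's method,
without uniqueness, and a measurable selection makes push-forwards meaningful; consistency applies
to every such flow. -/

noncomputable section

namespace WassersteinSubmanifold

/-! ### Measurable selection of convergent subsequences -/

section Selection

open Filter

variable {X Y : Type*} [MeasurableSpace X]

/-- One refinement step in the measurable extraction of a convergent subsequence. -/
lemma exists_measurable_index_refinement [PseudoMetricSpace Y] [MeasurableSpace Y] [BorelSpace Y]
    [SecondCountableTopology Y] {K : Set Y} (hK : IsCompact K) {f : ℕ → X → Y}
    (hf : ∀ n, Measurable (f n)) (hfK : ∀ n x, f n x ∈ K) {δ ε : ℝ} (hε : 0 < ε)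
    {N : X → ℕ} (hN : Measurable N)
    (hfr : ∀ x, ∃ᶠ n in atTop, dist (f n x) (f (N x) x) < δ) :
    ∃ N' : X → ℕ, Measurable N' ∧ (∀ x, N x < N' x) ∧
      (∀ x, dist (f (N' x) x) (f (N x) x) < δ) ∧
      ∀ x, ∃ᶠ n in atTop, dist (f n x) (f (N' x) x) < ε := by
  classical
  have hfN : Measurable fun x => f (N x) x :=
    (measurable_from_prod_countable_right (f := fun p : ℕ × X => f p.1 p.2) hf).comp
      (hN.prodMk measurable_id)
  let p : X → ℕ → Prop := fun x k => (N x < k ∧ dist (f k x) (f (N x) x) < δ) ∧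
    ∃ᶠ n in atTop, dist (f n x) (f k x) < ε
  have hp : ∀ x, ∃ k, p x k := by
    intro x
    -- The terms δ-close to the current one form an infinite family in a compact set, so they
    -- cluster at some y. Any late term within ε/2 of y then has infinitely many terms within ε of
    -- itself.
    obtain ⟨y, -, hy⟩ := hK.exists_mapClusterPt_of_frequently (f := fun n => f n x)
      (l := atTop ⊓ 𝓟 {n | dist (f n x) (f (N x) x) < δ})
      (by
        have : NeBot (atTop ⊓ 𝓟 {n | dist (f n x) (f (N x) x) < δ}) :=
          frequently_iff_neBot.1 (hfr x)
        exact (Eventually.of_forall fun n => hfK n x).frequently)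
    have h1 : ∃ᶠ n in atTop ⊓ 𝓟 {n | dist (f n x) (f (N x) x) < δ}, f n x ∈ Metric.ball y (ε / 2) :=
      hy.frequently (Metric.ball_mem_nhds y (half_pos hε))
    have h2 : ∃ᶠ n in atTop, dist (f n x) (f (N x) x) < δ ∧ dist (f n x) y < ε / 2 := by
      rw [frequently_inf_principal] at h1
      exact h1
    obtain ⟨k, hk, hk1, hk2⟩ := (h2.forall_exists_of_atTop (N x + 1))
    refine ⟨k, ⟨hk, hk1⟩, h2.mono fun n hn => ?_⟩
    calc dist (f n x) (f k x) ≤ dist (f n x) y + dist (f k x) y := dist_triangle_right _ _ _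
      _ < ε / 2 + ε / 2 := add_lt_add hn.2 hk2
      _ = ε := add_halves ε
  -- Taking the least admissible index makes the choice measurable in x.
  refine ⟨fun x => Nat.find (hp x), measurable_find hp fun k => ?_,
    fun x => (Nat.find_spec (hp x)).1.1, fun x => (Nat.find_spec (hp x)).1.2,
    fun x => (Nat.find_spec (hp x)).2⟩
  refine MeasurableSet.inter (MeasurableSet.inter ?_ ?_) ?_
  · exact measurableSet_lt hN measurable_const
  · exact measurableSet_lt ((hf k).dist hfN) measurable_const
  · have : {x | ∃ᶠ n in atTop, dist (f n x) (f k x) < ε} =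
        ⋂ a : ℕ, ⋃ n : ℕ, ⋃ _ : a ≤ n, {x | dist (f n x) (f k x) < ε} := by
      ext x; simp [frequently_atTop]
    change MeasurableSet {x | ∃ᶠ n in atTop, dist (f n x) (f k x) < ε}
    rw [this]
    exact MeasurableSet.iInter fun a => MeasurableSet.iUnion fun n => MeasurableSet.iUnion fun _ =>
      measurableSet_lt ((hf n).dist (hf k)) measurable_const

/-- From a sequence of measurable maps into a compact set one can extract, measurably in the
point, a convergent subsequence; its limit is measurable. -/
lemma exists_measurable_limit_of_compact [MetricSpace Y] [CompleteSpace Y] [MeasurableSpace Y]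
    [BorelSpace Y] [SecondCountableTopology Y] {K : Set Y} (hK : IsCompact K) {f : ℕ → X → Y}
    (hf : ∀ n, Measurable (f n)) (hfK : ∀ n x, f n x ∈ K) :
    ∃ g : X → Y, Measurable g ∧ ∀ x, ∃ m : ℕ → ℕ, StrictMono m ∧
      Tendsto (fun k => f (m k) x) atTop (𝓝 (g x)) := by
  let Q : ℕ → Set (X → ℕ) := fun k => {N | Measurable N ∧
    ∀ x, ∃ᶠ n in atTop, dist (f n x) (f (N x) x) < (1 / 2 : ℝ) ^ k}
  have hstep : ∀ k (N : Q k), ∃ N' : Q (k + 1), (∀ x, N.1 x < N'.1 x) ∧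
      ∀ x, dist (f (N'.1 x) x) (f (N.1 x) x) < (1 / 2 : ℝ) ^ k := by
    rintro k ⟨N, hN, hfr⟩
    obtain ⟨N', h1, h2, h3, h4⟩ := exists_measurable_index_refinement hK hf hfK
      (ε := (1 / 2 : ℝ) ^ (k + 1)) (by positivity) hN hfr
    exact ⟨⟨N', h1, h4⟩, h2, h3⟩
  choose next hnext1 hnext2 using hstep
  have hstart : ∃ N, N ∈ Q 0 := by
    -- With δ above the diameter of K, the constant index 0 is an admissible start.
    obtain ⟨N', h1, h2, h3, h4⟩ := exists_measurable_index_refinement hK hf hfK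
      (δ := Metric.diam K + 1) (ε := (1 / 2 : ℝ) ^ 0) (by positivity) (N := fun _ => 0)
      measurable_const (fun x => (Eventually.of_forall fun n => lt_of_le_of_lt
        (Metric.dist_le_diam_of_mem hK.isBounded (hfK n x) (hfK 0 x)) (lt_add_one _)).frequently)
    exact ⟨N', h1, h4⟩
  obtain ⟨N0, hN0⟩ := hstart
  let N : ∀ k, Q k := fun k => Nat.rec ⟨N0, hN0⟩ next k
  have hN1 : ∀ k x, (N k).1 x < (N (k + 1)).1 x := fun k => hnext1 k (N k)
  have hN2 : ∀ k x, dist (f ((N (k + 1)).1 x) x) (f ((N k).1 x) x) < (1 / 2 : ℝ) ^ k :=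
    fun k => hnext2 k (N k)
  have hlim : ∀ x, ∃ y, Tendsto (fun k => f ((N k).1 x) x) atTop (𝓝 y) := by
    intro x
    refine cauchySeq_tendsto_of_complete
      (cauchySeq_of_le_geometric (1 / 2) 1 (by norm_num) fun k => ?_)
    rw [dist_comm, one_mul]
    exact (hN2 k x).le
  choose g hg using hlim
  refine ⟨g, ?_, fun x => ⟨fun k => (N k).1 x, strictMono_nat_of_lt_succ fun k => hN1 k x, hg x⟩⟩
  refine measurable_of_tendsto_metrizable (f := fun k x => f ((N k).1 x) x) (fun k => ?_)
    (tendsto_pi_nhds.2 hg)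
  exact (measurable_from_prod_countable_right (f := fun p : ℕ × X => f p.1 p.2) hf).comp
    ((N k).2.1.prodMk measurable_id)

end Selection

/-! ### Peano existence with measurable dependence on the initial point -/

section Peano

open Filter

variable {V : Type*} [NormedAddCommGroup V] [NormedSpace ℝ V]

/-- Tonelli's delayed approximations of the solution of `u' = v(t, u)`, `u(0) = x`. -/
def delayedSolution (v : ℝ × V → V) (h : ℝ) : ℕ → ℝ → V → V
  | 0, _, x => x
  | k + 1, t, x => x + ∫ s in (0 : ℝ)..max t 0, v (s, delayedSolution v h k (s - h) x)

lemma continuous_delayedSolution {v : ℝ × V → V} (hv : Continuous v) (h : ℝ) (k : ℕ) :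
    Continuous fun p : ℝ × V => delayedSolution v h k p.1 p.2 := by
  induction k with
  | zero => exact continuous_snd
  | succ k ih =>
    refine continuous_snd.add ?_
    refine intervalIntegral.continuous_parametric_intervalIntegral_of_continuous
      (f := fun (p : ℝ × V) s => v (s, delayedSolution v h k (s - h) p.2)) ?_
      (continuous_fst.max continuous_const)
    have h1 : Continuous fun q : (ℝ × V) × ℝ => (q.2 - h, q.1.2) := by fun_prop
    exact hv.comp (continuous_snd.prodMk (ih.comp h1))

/-- The delay h means that values up to time (k + 1)h depend only on values up to time kh. The
iteration is thus stationary on each bounded time interval after finitely many steps, and its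
stationary value solves the delayed equation exactly. -/
lemma delayedSolution_succ_eq (v : ℝ × V → V) {h : ℝ} (hh : 0 < h) (x : V) (k : ℕ) :
    ∀ t ≤ k * h, delayedSolution v h (k + 1) t x = delayedSolution v h k t x := by
  induction k with
  | zero =>
    intro t ht
    have : max t 0 = 0 := max_eq_right (by simpa using ht)
    simp [delayedSolution, this]
  | succ k ih =>
    intro t ht
    rw [delayedSolution, delayedSolution]
    congr 1
    refine intervalIntegral.integral_congr fun s hs => ?_
    rw [uIcc_of_le (le_max_right t 0)] at hs
    have hs' : s - h ≤ k * h := by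
      push_cast at ht
      rcases le_max_iff.1 hs.2 with h1 | h1
      · linarith
      · have : 0 ≤ (k : ℝ) * h := by positivity
        linarith
    simp only [ih _ hs']

lemma norm_delayedSolution_sub_le {v : ℝ × V → V} (hv : Continuous v) {M : ℝ}
    (hM : ∀ p, ‖v p‖ ≤ M) (h : ℝ) (k : ℕ) (s t : ℝ) (x : V) :
    ‖delayedSolution v h k t x - delayedSolution v h k s x‖ ≤ M * |t - s| := by
  have hM0 : 0 ≤ M := (norm_nonneg _).trans (hM 0)
  cases k with
  | zero => simpa [delayedSolution] using mul_nonneg hM0 (abs_nonneg _)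
  | succ k =>
    have hc : Continuous fun s => v (s, delayedSolution v h k (s - h) x) :=
      hv.comp (continuous_id.prodMk ((continuous_delayedSolution hv h k).comp
        ((continuous_id.sub continuous_const).prodMk continuous_const)))
    rw [delayedSolution, delayedSolution, add_sub_add_left_eq_sub,
      intervalIntegral.integral_interval_sub_left (hc.intervalIntegrable _ _)
        (hc.intervalIntegrable _ _)]
    refine (intervalIntegral.norm_integral_le_of_norm_le_const fun s _ => hM _).trans ?_
    exact mul_le_mul_of_nonneg_left (abs_max_sub_max_le_abs t s 0) hM0

lemma delayedSolution_zero (v : ℝ × V → V) (h : ℝ) (k : ℕ) (x : V) :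
    delayedSolution v h k 0 x = x := by
  cases k <;> simp [delayedSolution]

lemma isCompact_setOf_lipschitz_bounded {W : Type*} [NormedAddCommGroup W] [ProperSpace W] (R M : ℝ) :
    IsCompact {u : C(Icc (0 : ℝ) 1, W) | (∀ t, u t ∈ Metric.closedBall (0 : W) R) ∧
      ∀ s t, dist (u t) (u s) ≤ M * dist t s} := by
  let e := ContinuousMap.isometryEquivBoundedOfCompact (Icc (0 : ℝ) 1) W
  rw [← e.toHomeomorph.isCompact_image]
  have hcl : ∀ t, Continuous fun u : C(Icc (0 : ℝ) 1, W) => u t := fun t => by fun_prop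
  refine BoundedContinuousFunction.arzela_ascoli₂ (Metric.closedBall (0 : W) R)
    (isCompact_closedBall _ _) _ ?_ ?_ ?_
  · rw [e.toHomeomorph.isClosed_image]
    have : {u : C(Icc (0 : ℝ) 1, W) | (∀ t, u t ∈ Metric.closedBall (0 : W) R) ∧
        ∀ s t, dist (u t) (u s) ≤ M * dist t s} =
        (⋂ t, {u | u t ∈ Metric.closedBall (0 : W) R}) ∩
          ⋂ s, ⋂ t, {u | dist (u t) (u s) ≤ M * dist t s} := by
      ext u; simp only [mem_inter_iff, mem_iInter]; rfl
    rw [this]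
    exact (isClosed_iInter fun t => Metric.isClosed_closedBall.preimage (hcl t)).inter
      (isClosed_iInter fun s => isClosed_iInter fun t =>
        isClosed_le ((hcl t).dist (hcl s)) continuous_const)
  · rintro f t ⟨u, hu, rfl⟩
    exact hu.1 t
  · refine Metric.equicontinuous_of_continuity_modulus (fun r => M * r) ?_ _ ?_
    · have : Continuous fun r : ℝ => M * r := by fun_prop
      simpa using this.tendsto 0
    · rintro s t ⟨_, u, hu, rfl⟩
      exact hu.2 t s

/-- **Peano's theorem with measurable dependence on the initial point**: a bounded continuous
time-dependent field has solutions on `[0,1]` that depend measurably on the initial value. -/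
theorem exists_measurable_solution [ProperSpace V] [MeasurableSpace V] [BorelSpace V]
    {v : ℝ × V → V} (hv : Continuous v) {M : ℝ} (hM : ∀ p, ‖v p‖ ≤ M)
    {Ω : Set V} (hΩ : IsCompact Ω) :
    ∃ Φ : ℝ → V → V, (∀ t, Measurable (Φ t)) ∧ (∀ x, Continuous fun t => Φ t x) ∧
      ∀ x ∈ Ω, ∀ t ∈ Icc (0 : ℝ) 1, Φ t x = x + ∫ s in (0 : ℝ)..t, v (s, Φ s x) := by
  classical
  have hM0 : 0 ≤ M := (norm_nonneg _).trans (hM 0)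
  obtain ⟨R, hR0, hR⟩ := hΩ.isBounded.subset_closedBall_lt 0 0
  -- Starting points outside Ω are sent to 0, so that all approximate solutions lie in one compact
  -- set of curves.
  let r : V → V := Ω.indicator id
  have hr : Measurable r := measurable_id.indicator hΩ.measurableSet
  have hrR : ∀ x, ‖r x‖ ≤ R := by
    intro x
    by_cases hx : x ∈ Ω
    · simpa [r, hx] using hR hx
    · simpa [r, hx] using hR0.le
  let U : ℕ → V → C(Icc (0 : ℝ) 1, V) := fun n x =>
    ⟨fun t => delayedSolution v (1 / (n + 1 : ℝ)) (n + 1) t x,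
      (continuous_delayedSolution hv (1 / (n + 1 : ℝ)) (n + 1)).comp
        (continuous_subtype_val.prodMk (continuous_const (y := x)))⟩
  have hU : ∀ n, Continuous (U n) := fun n =>
    ContinuousMap.continuous_of_continuous_uncurry _
      ((continuous_delayedSolution hv (1 / (n + 1 : ℝ)) (n + 1)).comp
        ((continuous_subtype_val.comp continuous_snd).prodMk continuous_fst))
  let mC : MeasurableSpace C(Icc (0 : ℝ) 1, V) := borel _
  have bC : BorelSpace C(Icc (0 : ℝ) 1, V) := ⟨rfl⟩
  -- The convergent subsequence may depend on x; the selection lemma keeps the limit curve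
  -- measurable in x.
  obtain ⟨g, hg, hlim⟩ := exists_measurable_limit_of_compact
    (isCompact_setOf_lipschitz_bounded (W := V) (R + M) M) (f := fun n x => U n (r x))
    (fun n => (hU n).measurable.comp hr) (fun n x => by
      constructor
      · intro t
        have h1 := norm_delayedSolution_sub_le hv hM (1 / (n + 1 : ℝ)) (n + 1) 0 t (r x)
        rw [delayedSolution_zero] at h1
        have h2 : |(t : ℝ) - 0| ≤ 1 := by
          rw [sub_zero, abs_of_nonneg t.2.1]; exact t.2.2
        rw [mem_closedBall_zero_iff]
        calc ‖U n (r x) t‖ ≤ ‖r x‖ + ‖U n (r x) t - r x‖ := norm_le_norm_add_norm_sub' _ _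
          _ ≤ R + M * |(t : ℝ) - 0| := add_le_add (hrR x) h1
          _ ≤ R + M := by nlinarith
      · intro s t
        rw [dist_eq_norm, Subtype.dist_eq, Real.dist_eq]
        exact norm_delayedSolution_sub_le hv hM _ _ _ _ _)
  let pr : ℝ → Icc (0 : ℝ) 1 := projIcc 0 1 zero_le_one
  have hpr : Continuous pr := continuous_projIcc
  refine ⟨fun t x => g x (pr t), fun t => ?_, fun x => (g x).continuous.comp hpr, ?_⟩
  · have : Continuous fun u : C(Icc (0 : ℝ) 1, V) => u (pr t) := by fun_prop
    exact this.measurable.comp hg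
  intro x hx t ht
  have hrx : r x = x := by simp [r, hx]
  obtain ⟨m, hm, hmlim⟩ := hlim x
  have hpt : ∀ s, Tendsto (fun k => U (m k) x s) atTop (𝓝 (g x s)) := fun s => by
    have : Continuous fun u : C(Icc (0 : ℝ) 1, V) => u s := by fun_prop
    simpa [hrx, Function.comp_def] using (this.tendsto (g x)).comp hmlim
  have hpiv : ∀ s ∈ Icc (0 : ℝ) 1, (pr s : ℝ) = s := fun s hs => by
    simp [pr, projIcc_of_mem zero_le_one hs]
  let w : ℕ → ℝ → V := fun n s => delayedSolution v (1 / (n + 1 : ℝ)) (n + 1) (s - 1 / (n + 1)) x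
  -- Shifting the argument by the delay 1/(n + 1) changes the curve by at most M/(n + 1).
  have hw : ∀ s ∈ Icc (0 : ℝ) 1, Tendsto (fun k => w (m k) s) atTop (𝓝 (g x (pr s))) := by
    intro s hs
    refine (hpt (pr s)).congr_dist ?_
    refine squeeze_zero (fun _ => dist_nonneg) (fun k => ?_)
      (g := fun k => M * (1 / ((m k : ℝ) + 1))) ?_
    · rw [dist_eq_norm]
      refine (norm_delayedSolution_sub_le hv hM _ _ (s - 1 / ((m k : ℝ) + 1)) (pr s) x).trans ?_
      rw [hpiv s hs, sub_sub_cancel, abs_of_nonneg (by positivity)]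
    · simpa using ((tendsto_one_div_add_atTop_nhds_zero_nat (𝕜 := ℝ)).comp
        hm.tendsto_atTop).const_mul M
  -- The n + 1 steps of length 1/(n + 1) reach exactly time 1, so the iterates n + 1 and n + 2 agree
  -- on [0,1].
  have heq : ∀ n, U n x (pr t) = x + ∫ s in (0 : ℝ)..t, v (s, w n s) := by
    intro n
    change delayedSolution v (1 / (n + 1 : ℝ)) (n + 1) (pr t) x = _
    rw [hpiv t ht, ← delayedSolution_succ_eq v (by positivity) x (n + 1) t
      (by push_cast; rw [mul_one_div_cancel (by positivity)]; exact ht.2), delayedSolution,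
      max_eq_left ht.1]
  have hint : Tendsto (fun k => ∫ s in (0 : ℝ)..t, v (s, w (m k) s)) atTop
      (𝓝 (∫ s in (0 : ℝ)..t, v (s, g x (pr s)))) := by
    refine intervalIntegral.tendsto_integral_filter_of_dominated_convergence (fun _ => M) ?_ ?_ ?_ ?_
    · refine Eventually.of_forall fun k => Continuous.aestronglyMeasurable ?_
      have h1 : Continuous fun s : ℝ => (s - 1 / ((m k : ℝ) + 1), x) := by fun_prop
      exact hv.comp (continuous_id.prodMk ((continuous_delayedSolution hv
        (1 / ((m k : ℝ) + 1)) (m k + 1)).comp h1))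
    · exact Eventually.of_forall fun k => Eventually.of_forall fun s _ => hM _
    · exact intervalIntegrable_const
    · refine Eventually.of_forall fun s hs => ?_
      rw [uIoc_of_le ht.1] at hs
      exact (hv.tendsto _).comp ((tendsto_const_nhds (x := s)).prodMk_nhds
        (hw s ⟨hs.1.le, hs.2.trans ht.2⟩))
  exact tendsto_nhds_unique (hpt (pr t)) (by simpa only [heq] using hint.const_add x)

end Peano

/-! ### Flows of fields with spatial bounds at the initial time only -/

section Flow

variable {d : ℕ}

/-- A time-dependent field, frozen outside of the time interval `[0,1]`. -/
def clampField (v : ℝ → Eucl d → Eucl d) (p : ℝ × Eucl d) : Eucl d :=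
  v (projIcc 0 1 zero_le_one p.1 : Icc (0 : ℝ) 1) p.2

lemma clampField_of_mem (v : ℝ → Eucl d → Eucl d) {t : ℝ} (ht : t ∈ Icc (0 : ℝ) 1) (x : Eucl d) :
    clampField v (t, x) = v t x := by
  simp [clampField, projIcc_of_mem zero_le_one ht]

/-- A field which is continuous in space and, uniformly, Lipschitz in time, with bounds at the
initial time. -/
structure IsTameField (v : ℝ → Eucl d → Eucl d) (a b : ℝ) : Prop where
  nonneg_left : 0 ≤ a
  nonneg_right : 0 ≤ b
  continuous : ∀ t ∈ Icc (0 : ℝ) 1, Continuous (v t)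
  time : ∀ x, ∀ s ∈ Icc (0 : ℝ) 1, ∀ t ∈ Icc (0 : ℝ) 1, ‖v t x - v s x‖ ≤ b * |t - s|
  init_bound : ∀ x, ‖v 0 x‖ ≤ a
  init_lip : ∀ x y, ‖v 0 x - v 0 y‖ ≤ a * ‖x - y‖

namespace IsTameField

variable {v : ℝ → Eucl d → Eucl d} {a b : ℝ}

/-- Continuity in x at each fixed time and a Lipschitz bound in t uniform in x together give joint
continuity; no uniform spatial modulus is needed. -/
lemma continuous_clampField (hv : IsTameField v a b) : Continuous (clampField v) := by
  refine continuous_prod_of_continuous_lipschitzWith _ (b.toNNReal) (fun t => ?_) (fun x => ?_)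
  · exact hv.continuous _ (projIcc 0 1 zero_le_one t).2
  · refine LipschitzWith.of_dist_le_mul fun t s => ?_
    rw [dist_eq_norm, Real.coe_toNNReal b hv.nonneg_right]
    refine (hv.time x _ (projIcc 0 1 zero_le_one s).2 _ (projIcc 0 1 zero_le_one t).2).trans ?_
    refine mul_le_mul_of_nonneg_left ?_ hv.nonneg_right
    rw [Real.dist_eq]
    exact abs_projIcc_sub_projIcc zero_le_one

lemma norm_le (hv : IsTameField v a b) {t : ℝ} (ht : t ∈ Icc (0 : ℝ) 1) (x : Eucl d) :
    ‖v t x‖ ≤ a + b := by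
  have h1 := hv.time x 0 (by simp) t ht
  rw [sub_zero, abs_of_nonneg ht.1] at h1
  have h2 : b * t ≤ b := mul_le_of_le_one_right hv.nonneg_right ht.2
  calc ‖v t x‖ ≤ ‖v 0 x‖ + ‖v t x - v 0 x‖ := norm_le_norm_add_norm_sub' _ _
    _ ≤ a + b := add_le_add (hv.init_bound x) (h1.trans h2)

lemma norm_clampField_le (hv : IsTameField v a b) (p : ℝ × Eucl d) : ‖clampField v p‖ ≤ a + b :=
  hv.norm_le (projIcc 0 1 zero_le_one p.1).2 _

end IsTameField

/-- `Φ` solves the ordinary differential equation with right-hand side `v` on `[0,1]`, starting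
from the points of `Ω`, with measurable dependence on the starting point. -/
structure IsSolutionMap (Ω : Set (Eucl d)) (v : ℝ → Eucl d → Eucl d)
    (Φ : ℝ → Eucl d → Eucl d) : Prop where
  measurable : ∀ t, Measurable (Φ t)
  continuous : ∀ x, Continuous fun t => Φ t x
  eq_integral : ∀ x ∈ Ω, ∀ t ∈ Icc (0 : ℝ) 1,
    Φ t x = x + ∫ s in (0 : ℝ)..t, clampField v (s, Φ s x)

lemma IsTameField.exists_isSolutionMap {v : ℝ → Eucl d → Eucl d} {a b : ℝ}
    (hv : IsTameField v a b) {Ω : Set (Eucl d)} (hΩ : IsCompact Ω) :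
    ∃ Φ, IsSolutionMap Ω v Φ := by
  obtain ⟨Φ, h1, h2, h3⟩ :=
    exists_measurable_solution hv.continuous_clampField hv.norm_clampField_le hΩ
  exact ⟨Φ, h1, h2, h3⟩

namespace IsSolutionMap

variable {Ω : Set (Eucl d)} {v : ℝ → Eucl d → Eucl d} {Φ : ℝ → Eucl d → Eucl d} {a b : ℝ}

lemma continuous_rhs (hΦ : IsSolutionMap Ω v Φ) (hv : IsTameField v a b) (x : Eucl d) :
    Continuous fun s => clampField v (s, Φ s x) :=
  hv.continuous_clampField.comp (continuous_id.prodMk (hΦ.continuous x))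

lemma init (hΦ : IsSolutionMap Ω v Φ) {x : Eucl d} (hx : x ∈ Ω) : Φ 0 x = x := by
  simpa using hΦ.eq_integral x hx 0 (by simp)

lemma hasDerivWithinAt (hΦ : IsSolutionMap Ω v Φ) (hv : IsTameField v a b) {x : Eucl d}
    (hx : x ∈ Ω) {t : ℝ} (ht : t ∈ Icc (0 : ℝ) 1) :
    HasDerivWithinAt (fun s => Φ s x) (v t (Φ t x)) (Icc 0 1) t := by
  have h1 : HasDerivAt (fun u => x + ∫ s in (0 : ℝ)..u, clampField v (s, Φ s x))
      (clampField v (t, Φ t x)) t :=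
    ((hΦ.continuous_rhs hv x).integral_hasStrictDerivAt 0 t).hasDerivAt.const_add x
  rw [← clampField_of_mem v ht]
  exact h1.hasDerivWithinAt.congr (fun s hs => hΦ.eq_integral x hx s hs) (hΦ.eq_integral x hx t ht)

lemma norm_sub_le (hΦ : IsSolutionMap Ω v Φ) (hv : IsTameField v a b) {x : Eucl d}
    (hx : x ∈ Ω) {s t : ℝ} (hs : s ∈ Icc (0 : ℝ) 1) (ht : t ∈ Icc (0 : ℝ) 1) :
    ‖Φ t x - Φ s x‖ ≤ (a + b) * |t - s| := by
  rw [hΦ.eq_integral x hx t ht, hΦ.eq_integral x hx s hs, add_sub_add_left_eq_sub,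
    intervalIntegral.integral_interval_sub_left ((hΦ.continuous_rhs hv x).intervalIntegrable _ _)
      ((hΦ.continuous_rhs hv x).intervalIntegrable _ _)]
  exact intervalIntegral.norm_integral_le_of_norm_le_const fun s _ => hv.norm_clampField_le _

lemma norm_sub_init_le (hΦ : IsSolutionMap Ω v Φ) (hv : IsTameField v a b) {x : Eucl d}
    (hx : x ∈ Ω) {t : ℝ} (ht : t ∈ Icc (0 : ℝ) 1) : ‖Φ t x - x‖ ≤ a + b := by
  have h := hΦ.norm_sub_le hv hx (s := 0) (by simp) ht
  rw [hΦ.init hx, sub_zero, abs_of_nonneg ht.1] at h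
  exact h.trans (mul_le_of_le_one_right (add_nonneg hv.nonneg_left hv.nonneg_right) ht.2)

/-- The comparison first returns to time 0 at the moved point and only then moves the point back,
because the spatial Lipschitz bound is known only at time 0. -/
lemma norm_field_sub_init_le (hΦ : IsSolutionMap Ω v Φ) (hv : IsTameField v a b) {x : Eucl d}
    (hx : x ∈ Ω) {t : ℝ} (ht : t ∈ Icc (0 : ℝ) 1) :
    ‖v t (Φ t x) - v 0 x‖ ≤ b + a * (a + b) := by
  have h1 := hv.time (Φ t x) 0 (by simp) t ht
  rw [sub_zero, abs_of_nonneg ht.1] at h1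
  have h2 : b * t ≤ b := mul_le_of_le_one_right hv.nonneg_right ht.2
  calc ‖v t (Φ t x) - v 0 x‖ ≤ ‖v t (Φ t x) - v 0 (Φ t x)‖ + ‖v 0 (Φ t x) - v 0 x‖ :=
        norm_sub_le_norm_sub_add_norm_sub _ _ _
    _ ≤ b + a * (a + b) := add_le_add (h1.trans h2) ((hv.init_lip _ _).trans
        (mul_le_mul_of_nonneg_left (hΦ.norm_sub_init_le hv hx ht) hv.nonneg_left))

lemma norm_displacement_sub_le (hΦ : IsSolutionMap Ω v Φ) (hv : IsTameField v a b) {x : Eucl d}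
    (hx : x ∈ Ω) : ‖Φ 1 x - x - v 0 x‖ ≤ b + a * (a + b) := by
  have h0 : Φ 1 x - x - v 0 x = ∫ s in (0 : ℝ)..1, (clampField v (s, Φ s x) - v 0 x) := by
    rw [intervalIntegral.integral_sub ((hΦ.continuous_rhs hv x).intervalIntegrable _ _)
      intervalIntegrable_const, hΦ.eq_integral x hx 1 (by simp)]
    simp
  rw [h0]
  refine (intervalIntegral.norm_integral_le_of_norm_le_const
    (C := b + a * (a + b)) fun s hs => ?_).trans (by simp)
  rw [uIoc_of_le zero_le_one] at hs
  have hs' : s ∈ Icc (0 : ℝ) 1 := ⟨hs.1.le, hs.2⟩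
  rw [clampField_of_mem v hs']
  exact hΦ.norm_field_sub_init_le hv hx hs'

lemma isFlow (hΦ : IsSolutionMap Ω v Φ) (hv : IsTameField v a b) (μ : Measure (Eucl d)) :
    IsFlow Ω μ v Φ where
  init _ hx := hΦ.init hx
  absCont x hx := by
    refine LipschitzOnWith.absolutelyContinuousOnInterval (K := (a + b).toNNReal) ?_
    rw [uIcc_of_le zero_le_one]
    refine LipschitzOnWith.of_dist_le_mul fun t ht s hs => ?_
    rw [dist_eq_norm, Real.dist_eq,
      Real.coe_toNNReal _ (add_nonneg hv.nonneg_left hv.nonneg_right)]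
    exact hΦ.norm_sub_le hv hx hs ht
  ode := by
    filter_upwards [ae_restrict_mem measurableSet_Icc] with t ht x hx
    exact hΦ.hasDerivWithinAt hv hx ht
  aemeasurable t _ := (hΦ.measurable t).aemeasurable

lemma measurable_uncurry (hΦ : IsSolutionMap Ω v Φ) :
    Measurable fun p : ℝ × Eucl d => Φ p.1 p.2 :=
  measurable_uncurry_of_continuous_of_measurable (u := Φ) hΦ.continuous hΦ.measurable

end IsSolutionMap

end Flow

/-! ### Push-forwards along flows solve the continuity equation -/

section ContinuityEquation

variable {d : ℕ}

lemma deriv_partial_time {φ : ℝ × Eucl d → ℝ} (hφ : ContDiff ℝ 1 φ) (t : ℝ) (x : Eucl d) :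
    deriv (fun s => φ (s, x)) t = fderiv ℝ φ (t, x) (1, 0) := by
  have h1 : HasFDerivAt φ (fderiv ℝ φ (t, x)) (t, x) :=
    (hφ.differentiable one_ne_zero).differentiableAt.hasFDerivAt
  exact (h1.comp_hasDerivAt t ((hasDerivAt_id t).prodMk (hasDerivAt_const t x))).deriv

lemma inner_gradient_partial_space {φ : ℝ × Eucl d → ℝ} (hφ : ContDiff ℝ 1 φ) (t : ℝ)
    (x w : Eucl d) :
    inner ℝ (gradient (fun y => φ (t, y)) x) w = fderiv ℝ φ (t, x) (0, w) := by
  have h1 : HasFDerivAt φ (fderiv ℝ φ (t, x)) (t, x) :=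
    (hφ.differentiable one_ne_zero).differentiableAt.hasFDerivAt
  have h2 : HasFDerivAt (fun y => φ (t, y))
      ((fderiv ℝ φ (t, x)).comp (ContinuousLinearMap.inr ℝ ℝ (Eucl d))) x :=
    h1.comp x (hasFDerivAt_prodMk_right t x)
  rw [gradient, h2.fderiv, InnerProductSpace.toDual_symm_apply]
  rfl

/-- The push-forwards along the solutions of an ordinary differential equation solve the
continuity equation. -/
lemma IsSolutionMap.isContinuityEq {Ω : Set (Eucl d)} (hΩ : IsCompact Ω)
    {v : ℝ → Eucl d → Eucl d} {Φ : ℝ → Eucl d → Eucl d} {a b : ℝ}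
    (hΦ : IsSolutionMap Ω v Φ) (hv : IsTameField v a b)
    {μ : Measure (Eucl d)} [IsProbabilityMeasure μ] (hμ : μ Ωᶜ = 0)
    {ρ : ℝ → Measure (Eucl d)} (hρ : ∀ t ∈ Icc (0 : ℝ) 1, ρ t = μ.map (Φ t)) :
    IsContinuityEq ρ (fun t x => clampField v (t, x)) where
  measurable := hv.continuous_clampField.measurable
  memLp t ht := by
    have : IsProbabilityMeasure (ρ t) := by
      rw [hρ t ht]; exact Measure.isProbabilityMeasure_map (hΦ.measurable t).aemeasurable
    exact MemLp.of_bound (hv.continuous_clampField.comp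
      (continuous_const.prodMk continuous_id)).aestronglyMeasurable (a + b)
      (Filter.Eventually.of_forall fun x => hv.norm_clampField_le _)
  eq φ hφ := by
    have hφc : Continuous φ := hφ.continuous
    have hφ' : Continuous (fderiv ℝ φ) := hφ.continuous_fderiv one_ne_zero
    have hvc := hv.continuous_clampField
    let G₁ : ℝ × Eucl d → ℝ := fun q => fderiv ℝ φ q (1, 0)
    let G₂ : ℝ × Eucl d → ℝ := fun q => fderiv ℝ φ q (0, clampField v q)
    have hG₁ : Continuous G₁ := hφ'.clm_apply continuous_const
    have hG₂ : Continuous G₂ := hφ'.clm_apply (continuous_const.prodMk hvc)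
    let Ψ : ℝ × Eucl d → ℝ × Eucl d := fun p => (p.1, Φ p.1 p.2)
    have hΨ : Measurable Ψ := measurable_fst.prodMk hΦ.measurable_uncurry
    have hae : ∀ᵐ x ∂μ, x ∈ Ω := by rwa [ae_iff]
    obtain ⟨R, hR⟩ := hΩ.isBounded.subset_closedBall 0
    -- Test functions need not be bounded, but all trajectories starting in Ω stay in this compact
    -- set, which justifies Fubini.
    let K : Set (ℝ × Eucl d) := Icc 0 1 ×ˢ Metric.closedBall 0 (R + (a + b))
    have hK : IsCompact K := isCompact_Icc.prod (isCompact_closedBall _ _)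
    have hmem : ∀ x ∈ Ω, ∀ t ∈ Icc (0 : ℝ) 1, Ψ (t, x) ∈ K := by
      intro x hx t ht
      refine ⟨ht, ?_⟩
      have h1 := hΦ.norm_sub_init_le hv hx ht
      have h2 : ‖x‖ ≤ R := by simpa using hR hx
      rw [mem_closedBall_zero_iff]
      calc ‖Φ t x‖ ≤ ‖x‖ + ‖Φ t x - x‖ := norm_le_norm_add_norm_sub' _ _
        _ ≤ R + (a + b) := add_le_add h2 h1
    have hint : ∀ G : ℝ × Eucl d → ℝ, Continuous G →
        Integrable (fun p => G (Ψ p)) ((volume.restrict (Ioc (0 : ℝ) 1)).prod μ) := by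
      intro G hG
      obtain ⟨c, hc⟩ := hK.exists_bound_of_continuousOn hG.continuousOn
      refine Integrable.of_bound (hG.measurable.comp hΨ).aestronglyMeasurable c ?_
      have h1 : ∀ᵐ p ∂((volume.restrict (Ioc (0 : ℝ) 1)).prod μ), p.1 ∈ Ioc (0 : ℝ) 1 :=
        Measure.quasiMeasurePreserving_fst.ae (ae_restrict_mem measurableSet_Ioc)
      have h2 : ∀ᵐ p ∂((volume.restrict (Ioc (0 : ℝ) 1)).prod μ), p.2 ∈ Ω :=
        Measure.quasiMeasurePreserving_snd.ae hae
      filter_upwards [h1, h2] with p hp1 hp2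
      exact hc _ (hmem p.2 hp2 p.1 ⟨hp1.1.le, hp1.2⟩)
    have hpush : ∀ G : ℝ × Eucl d → ℝ, Continuous G → ∀ t ∈ Icc (0 : ℝ) 1,
        ∫ x, G (t, x) ∂(ρ t) = ∫ x, G (Ψ (t, x)) ∂μ := by
      intro G hG t ht
      rw [hρ t ht, integral_map (hΦ.measurable t).aemeasurable]
      exact (hG.comp (continuous_const.prodMk continuous_id)).aestronglyMeasurable
    have hswap : ∀ G : ℝ × Eucl d → ℝ, Continuous G →
        ∫ t in (0 : ℝ)..1, ∫ x, G (t, x) ∂(ρ t) = ∫ x, (∫ t in (0 : ℝ)..1, G (Ψ (t, x))) ∂μ := by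
      intro G hG
      simp only [intervalIntegral.integral_of_le zero_le_one]
      rw [← integral_integral_swap (f := fun t x => G (Ψ (t, x))) (hint G hG)]
      refine setIntegral_congr_fun measurableSet_Ioc fun t ht => ?_
      exact hpush G hG t ⟨ht.1.le, ht.2⟩
    have hGint : ∀ G : ℝ × Eucl d → ℝ, Continuous G →
        Integrable (fun x => ∫ t in (0 : ℝ)..1, G (Ψ (t, x))) μ := by
      intro G hG
      simp only [intervalIntegral.integral_of_le zero_le_one]
      exact (hint G hG).integral_prod_right
    have hcΨ : ∀ x, Continuous fun t => Ψ (t, x) := fun x =>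
      continuous_id.prodMk (hΦ.continuous x)
    have hφint : ∀ t ∈ Icc (0 : ℝ) 1, Integrable (fun x => φ (Ψ (t, x))) μ := by
      intro t ht
      obtain ⟨c, hc⟩ := hK.exists_bound_of_continuousOn hφc.continuousOn
      refine Integrable.of_bound (hφc.measurable.comp
        (hΨ.comp measurable_prodMk_left)).aestronglyMeasurable c ?_
      filter_upwards [hae] with x hx
      exact hc _ (hmem x hx t ht)
    have e1 : (∫ t in (0 : ℝ)..1, ∫ x, deriv (fun s => φ (s, x)) t ∂(ρ t)) =
        ∫ x, (∫ t in (0 : ℝ)..1, G₁ (Ψ (t, x))) ∂μ := by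
      rw [← hswap G₁ hG₁]
      simp only [deriv_partial_time hφ, G₁]
    have e2 : (∫ t in (0 : ℝ)..1, ∫ x, inner ℝ (gradient (fun y => φ (t, y)) x)
        (clampField v (t, x)) ∂(ρ t)) = ∫ x, (∫ t in (0 : ℝ)..1, G₂ (Ψ (t, x))) ∂μ := by
      rw [← hswap G₂ hG₂]
      simp only [inner_gradient_partial_space hφ, G₂]
    rw [e1, e2, ← integral_add (hGint G₁ hG₁) (hGint G₂ hG₂), hpush φ hφc 1 (by simp),
      hpush φ hφc 0 (by simp), ← integral_sub (hφint 1 (by simp)) (hφint 0 (by simp))]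
    refine integral_congr_ae ?_
    filter_upwards [hae] with x hx
    have c1 : Continuous fun t => G₁ (Ψ (t, x)) := hG₁.comp (hcΨ x)
    have c2 : Continuous fun t => G₂ (Ψ (t, x)) := hG₂.comp (hcΨ x)
    rw [← intervalIntegral.integral_add (c1.intervalIntegrable _ _) (c2.intervalIntegrable _ _)]
    -- After Fubini the equation is the fundamental theorem of calculus for φ along a single
    -- trajectory.
    refine intervalIntegral.integral_eq_sub_of_hasDeriv_right_of_le zero_le_one
      (f := fun t => φ (Ψ (t, x))) (hφc.comp (hcΨ x)).continuousOn (fun t ht => ?_)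
      ((c1.add c2).intervalIntegrable _ _)
    have ht' : t ∈ Icc (0 : ℝ) 1 := ⟨ht.1.le, ht.2.le⟩
    have h1 : HasDerivAt (fun s => Φ s x) (v t (Φ t x)) t :=
      (hΦ.hasDerivWithinAt hv hx ht').hasDerivAt (Icc_mem_nhds ht.1 ht.2)
    have h2 : HasFDerivAt φ (fderiv ℝ φ (Ψ (t, x))) (Ψ (t, x)) :=
      (hφ.differentiable one_ne_zero).differentiableAt.hasFDerivAt
    have h3 := h2.comp_hasDerivAt t ((hasDerivAt_id t).prodMk h1)
    have h4 : G₁ (Ψ (t, x)) + G₂ (Ψ (t, x)) = fderiv ℝ φ (Ψ (t, x)) (1, v t (Φ t x)) := by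
      simp only [G₁, G₂, Ψ, clampField_of_mem v ht', ← map_add]
      simp
    rw [h4]
    exact h3.hasDerivWithinAt

end ContinuityEquation

/-! ### Upper bounds for the Wasserstein distance -/

section Coupling

variable {d : ℕ}

lemma wassEDist_le_of_coupling {μ ν : Measure (Eucl d)} (κ : Measure (Eucl d × Eucl d))
    [IsProbabilityMeasure κ] (h₁ : κ.map Prod.fst = μ) (h₂ : κ.map Prod.snd = ν) {r : ℝ}
    (hr : ∀ᵐ p ∂κ, ‖p.1 - p.2‖ ≤ r) : wassEDist μ ν ≤ ENNReal.ofReal r := by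
  have h : ∫⁻ p, ‖p.1 - p.2‖ₑ ^ 2 ∂κ ≤ ENNReal.ofReal r ^ 2 := by
    calc ∫⁻ p, ‖p.1 - p.2‖ₑ ^ 2 ∂κ ≤ ∫⁻ _, ENNReal.ofReal r ^ 2 ∂κ := by
          refine lintegral_mono_ae ?_
          filter_upwards [hr] with p hp
          gcongr
          rw [← ofReal_norm]
          exact ENNReal.ofReal_le_ofReal hp
      _ = ENNReal.ofReal r ^ 2 := by simp
  calc wassEDist μ ν ≤ (ENNReal.ofReal r ^ 2) ^ (1 / 2 : ℝ) := by
        refine ENNReal.rpow_le_rpow ?_ (by norm_num)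
        exact (iInf₂_le_of_le κ h₁ (iInf_le_of_le h₂ le_rfl)).trans h
    _ = ENNReal.ofReal r := by
        rw [← ENNReal.rpow_natCast, ← ENNReal.rpow_mul]; norm_num

lemma wassEDist_le_of_concentrated {Ω : Set (Eucl d)} {μ ν : Measure (Eucl d)}
    [IsProbabilityMeasure μ] [IsProbabilityMeasure ν] (hμ : μ Ωᶜ = 0) (hν : ν Ωᶜ = 0) {r : ℝ}
    (hr : ∀ x ∈ Ω, ∀ y ∈ Ω, ‖x - y‖ ≤ r) : wassEDist μ ν ≤ ENNReal.ofReal r := by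
  refine wassEDist_le_of_coupling (μ.prod ν) (by simp [Measure.map_fst_prod])
    (by simp [Measure.map_snd_prod]) ?_
  have h1 : ∀ᵐ p ∂(μ.prod ν), p.1 ∈ Ω :=
    Measure.quasiMeasurePreserving_fst.ae (p := fun x => x ∈ Ω) (by rwa [ae_iff])
  have h2 : ∀ᵐ p ∂(μ.prod ν), p.2 ∈ Ω :=
    Measure.quasiMeasurePreserving_snd.ae (p := fun x => x ∈ Ω) (by rwa [ae_iff])
  filter_upwards [h1, h2] with p hp1 hp2 using hr _ hp1 _ hp2

lemma wassEDist_map_le {μ : Measure (Eucl d)} [IsProbabilityMeasure μ] {S T : Eucl d → Eucl d}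
    (hS : Measurable S) (hT : Measurable T) {r : ℝ} (hr : ∀ᵐ x ∂μ, ‖S x - T x‖ ≤ r) :
    wassEDist (μ.map S) (μ.map T) ≤ ENNReal.ofReal r := by
  have hST : Measurable fun x => (S x, T x) := hS.prodMk hT
  have : IsProbabilityMeasure (μ.map fun x => (S x, T x)) :=
    Measure.isProbabilityMeasure_map hST.aemeasurable
  refine wassEDist_le_of_coupling (μ.map fun x => (S x, T x)) ?_ ?_ ?_
  · rw [Measure.map_map measurable_fst hST]; rfl
  · rw [Measure.map_map measurable_snd hST]; rfl
  · rw [ae_map_iff hST.aemeasurable (measurableSet_le (by fun_prop) measurable_const)]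
    exact hr

end Coupling

/-! ### Geodesics of D and the transport along them -/

section Geodesics

variable {d : ℕ} {F : Type*} [NormedAddCommGroup F] [NormedSpace ℝ F]
  {M : Type*} [TopologicalSpace M] [ChartedSpace F M]
  [RiemannianBundle (fun x : M => TangentSpace 𝓘(ℝ, F) x)]
  {S : Set M} {D : Set (TangentBundle 𝓘(ℝ, F) M)}
  {θ : M} {η : TangentSpace 𝓘(ℝ, F) θ}

lemma intrinsicEDist_le_of_speed {γ : ℝ → M}
    (hγ : ContMDiffOn 𝓘(ℝ, ℝ) 𝓘(ℝ, F) 1 γ (Icc 0 1)) (hS : MapsTo γ (Icc 0 1) S) {c : ℝ≥0}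
    (hc : ∀ t ∈ Icc (0 : ℝ) 1, ‖velocity F γ t‖ₑ ≤ c) {s t : ℝ} (hs : s ∈ Icc (0 : ℝ) 1)
    (ht : t ∈ Icc (0 : ℝ) 1) : intrinsicEDist F S (γ s) (γ t) ≤ c * edist s t := by
  have hlen : ∀ a ∈ Icc (0 : ℝ) 1, ∀ b ∈ Icc (0 : ℝ) 1,
      pathELength 𝓘(ℝ, F) γ a b ≤ c * ENNReal.ofReal (b - a) := by
    intro a ha b hb
    rw [pathELength_eq_lintegral_mfderiv_Ioo]
    calc _ ≤ ∫⁻ _ in Ioo a b, (c : ℝ≥0∞) := by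
          refine setLIntegral_mono measurable_const fun u hu => ?_
          have h1 : Icc (0 : ℝ) 1 ∈ 𝓝 u :=
            Icc_mem_nhds (ha.1.trans_lt hu.1) (hu.2.trans_le hb.2)
          have h2 := hc u (mem_of_mem_nhds h1)
          rwa [velocity, mfderivWithin_of_mem_nhds h1] at h2
      _ = c * ENNReal.ofReal (b - a) := by simp
  -- The piece of γ between s and t, reparametrized over [0,1], is the competitor; it runs backwards
  -- when t < s.
  let f : ℝ → ℝ := fun u => s + u * (t - s)
  have hfd : Differentiable ℝ f := by fun_prop
  have hfI : MapsTo f (Icc 0 1) (Icc 0 1) := by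
    intro u hu
    have h1 : f u = (1 - u) * s + u * t := by simp only [f]; ring
    rw [h1]
    constructor
    · have := hs.1; have := ht.1; have := hu.1; have : 0 ≤ 1 - u := by linarith [hu.2]
      positivity
    · nlinarith [hs.2, ht.2, hu.1, hu.2]
  have hf0 : f 0 = s := by simp [f]
  have hf1 : f 1 = t := by simp [f]
  have hmd : MDifferentiableOn 𝓘(ℝ, ℝ) 𝓘(ℝ, F) γ (Icc 0 1) := hγ.mdifferentiableOn one_ne_zero
  have hpath : intrinsicEDist F S (γ s) (γ t) ≤ pathELength 𝓘(ℝ, F) (γ ∘ f) 0 1 := by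
    refine iInf₂_le_of_le (γ ∘ f) ?_ (iInf₂_le_of_le (hS.comp hfI) (by simp [hf0])
      (iInf_le_of_le (by simp [hf1]) le_rfl))
    refine hγ.comp ?_ hfI
    have : ContDiff ℝ 1 f := by fun_prop
    exact this.contMDiff.contMDiffOn
  refine hpath.trans ?_
  rcases le_total s t with hst | hst
  · rw [pathELength_comp_of_monotoneOn zero_le_one
      (fun x _ y _ hxy => by simp only [f]; nlinarith) hfd.differentiableOn
      (hmd.mono (by rw [hf0, hf1]; exact Icc_subset_Icc hs.1 ht.2)), hf0, hf1]
    refine (hlen s hs t ht).trans_eq ?_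
    rw [edist_dist, Real.dist_eq, abs_sub_comm, abs_of_nonneg (sub_nonneg.2 hst)]
  · rw [pathELength_comp_of_antitoneOn zero_le_one
      (fun x _ y _ hxy => by simp only [f]; nlinarith) hfd.differentiableOn
      (hmd.mono (by rw [hf0, hf1]; exact Icc_subset_Icc ht.1 hs.2)), hf0, hf1]
    refine (hlen t ht s hs).trans_eq ?_
    rw [edist_dist, Real.dist_eq, abs_of_nonneg (sub_nonneg.2 hst)]

namespace IsParameterManifold

lemma expCurve_zero (hS : IsParameterManifold S D)
    (hη : (⟨θ, η⟩ : TangentBundle 𝓘(ℝ, F) M) ∈ D) : expCurve θ η 0 = θ :=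
  congrArg TotalSpace.proj (hS.geodesic θ η hη).2

lemma field_zero (hS : IsParameterManifold S D)
    (hη : (⟨θ, η⟩ : TangentBundle 𝓘(ℝ, F) M) ∈ D)
    (B : ∀ θ : M, TangentSpace 𝓘(ℝ, F) θ →ₗ[ℝ] (Eucl d → Eucl d)) :
    B (expCurve θ η 0) (velocity F (expCurve θ η) 0) = B θ η :=
  congrArg (fun p : TangentBundle 𝓘(ℝ, F) M => B p.1 p.2) (hS.geodesic θ η hη).2

lemma exp_mem (hS : IsParameterManifold S D)
    (hη : (⟨θ, η⟩ : TangentBundle 𝓘(ℝ, F) M) ∈ D) : riemExp θ η ∈ S := by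
  simpa [expCurve] using hS.mapsTo θ η hη (show (1 : ℝ) ∈ Icc (0 : ℝ) 1 by simp)

lemma intrinsicEDist_expCurve_le (hS : IsParameterManifold S D)
    (hη : (⟨θ, η⟩ : TangentBundle 𝓘(ℝ, F) M) ∈ D) {s t : ℝ} (hs : s ∈ Icc (0 : ℝ) 1)
    (ht : t ∈ Icc (0 : ℝ) 1) :
    intrinsicEDist F S (expCurve θ η s) (expCurve θ η t) ≤ ‖η‖₊ * edist s t := by
  refine intrinsicEDist_le_of_speed ((hS.geodesic θ η hη).1.smooth.of_le (by simp))
    (hS.mapsTo θ η hη) (fun u hu => ?_) hs ht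
  rw [← ofReal_norm, hS.speed θ η hη u hu, ofReal_norm]
  rfl

lemma isLipCurveOn_expCurve (hS : IsParameterManifold S D)
    (hη : (⟨θ, η⟩ : TangentBundle 𝓘(ℝ, F) M) ∈ D) : IsLipCurveOn F S (expCurve θ η) :=
  ⟨hS.mapsTo θ η hη, ‖η‖₊, fun _ hs _ ht => hS.intrinsicEDist_expCurve_le hη hs ht⟩

/-- Tangent vectors in `D` are uniformly bounded. -/
lemma exists_norm_le (hS : IsParameterManifold S D) {Ω : Set (Eucl d)} (hΩ : IsCompact Ω)
    {E : M → Measure (Eucl d)} (hE : IsEmbeddingOn (F := F) Ω S E) :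
    ∃ R : ℝ, 0 ≤ R ∧ ∀ (θ : M) (η : TangentSpace 𝓘(ℝ, F) θ),
      (⟨θ, η⟩ : TangentBundle 𝓘(ℝ, F) M) ∈ D → ‖η‖ ≤ R := by
  obtain ⟨L, hL⟩ := hE.biLipschitz
  refine ⟨L * Metric.diam Ω, by positivity, fun θ η hη => ?_⟩
  have hθ := hS.base_mem θ η hη
  have hθ' := hS.exp_mem hη
  have := hE.isProbabilityMeasure θ hθ
  have := hE.isProbabilityMeasure _ hθ'
  -- The bound comes from the target side: ‖η‖ is an intrinsic distance, hence at most L times a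
  -- Wasserstein distance, and all the measures live on the bounded set Ω.
  have h1 : ‖η‖ₑ ≤ L * ENNReal.ofReal (Metric.diam Ω) := by
    rw [hS.minimizing θ η hη]
    refine (hL θ hθ _ hθ').2.trans ?_
    gcongr
    refine wassEDist_le_of_concentrated (hE.concentrated θ hθ) (hE.concentrated _ hθ') ?_
    intro x hx y hy
    rw [← dist_eq_norm]
    exact Metric.dist_le_diam_of_mem hΩ.isBounded hx hy
  rw [← ofReal_norm, ← ENNReal.ofReal_coe_nnreal, ← ENNReal.ofReal_mul (by positivity)] at h1
  exact (ENNReal.ofReal_le_ofReal_iff (by positivity)).1 h1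

end IsParameterManifold

/-- The velocity field `B_{γ(t)} γ̇(t)` along `γ(t) = exp_θ(t η)`. -/
def geodesicField (B : ∀ θ : M, TangentSpace 𝓘(ℝ, F) θ →ₗ[ℝ] (Eucl d → Eucl d))
    (θ : M) (η : TangentSpace 𝓘(ℝ, F) θ) (t : ℝ) : Eucl d → Eucl d :=
  B (expCurve θ η t) (velocity F (expCurve θ η) t)

/-- Uniform pointwise bounds for the velocity fields of tangent vectors in `D`. -/
structure HasFieldBounds (D : Set (TangentBundle 𝓘(ℝ, F) M)) (E : M → Measure (Eucl d))
    (B : ∀ θ : M, TangentSpace 𝓘(ℝ, F) θ →ₗ[ℝ] (Eucl d → Eucl d)) (C : ℝ) : Prop where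
  pos : 0 < C
  lower : ∀ (θ : M) (η : TangentSpace 𝓘(ℝ, F) θ), (⟨θ, η⟩ : TangentBundle 𝓘(ℝ, F) M) ∈ D →
    ‖η‖ ≤ C * lpNorm (B θ η) 2 (E θ)
  upper : ∀ (θ : M) (η : TangentSpace 𝓘(ℝ, F) θ), (⟨θ, η⟩ : TangentBundle 𝓘(ℝ, F) M) ∈ D →
    lpNorm (B θ η) 2 (E θ) ≤ C * ‖η‖
  norm_le : ∀ (θ : M) (η : TangentSpace 𝓘(ℝ, F) θ), (⟨θ, η⟩ : TangentBundle 𝓘(ℝ, F) M) ∈ D →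
    ∀ x, ‖B θ η x‖ ≤ C * ‖η‖
  lip : ∀ (θ : M) (η : TangentSpace 𝓘(ℝ, F) θ), (⟨θ, η⟩ : TangentBundle 𝓘(ℝ, F) M) ∈ D →
    ∀ x y, ‖B θ η x - B θ η y‖ ≤ C * ‖η‖ * ‖x - y‖
  tame : ∀ (θ : M) (η : TangentSpace 𝓘(ℝ, F) θ), (⟨θ, η⟩ : TangentBundle 𝓘(ℝ, F) M) ∈ D →
    IsTameField (geodesicField B θ η) (C * ‖η‖) (C * ‖η‖ ^ 2)

lemma IsVelocityFamily.exists_hasFieldBounds {E : M → Measure (Eucl d)}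
    {B : ∀ θ : M, TangentSpace 𝓘(ℝ, F) θ →ₗ[ℝ] (Eucl d → Eucl d)}
    (hB : IsVelocityFamily S D E B) (hS : IsParameterManifold S D) :
    ∃ C, HasFieldBounds D E B C := by
  obtain ⟨C, hC, h⟩ := hB.bounds
  have hlip : ∀ (θ : M) (η : TangentSpace 𝓘(ℝ, F) θ), (⟨θ, η⟩ : TangentBundle 𝓘(ℝ, F) M) ∈ D →
      ∀ x y, ‖B θ η x - B θ η y‖ ≤ C * ‖η‖ * ‖x - y‖ := by
    intro θ η hη x y
    refine convex_univ.norm_image_sub_le_of_norm_fderiv_le (𝕜 := ℝ) (fun z _ => ?_)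
      (fun z _ => ((h θ η hη).2.1 z).2) (mem_univ y) (mem_univ x)
    exact ((hB.contDiff θ (hS.base_mem θ η hη) η).differentiable one_ne_zero).differentiableAt
  refine ⟨C, hC, fun θ η hη => ?_, fun θ η hη => (h θ η hη).1.2,
    fun θ η hη x => ((h θ η hη).2.1 x).1, hlip, fun θ η hη => ?_⟩
  · have := (h θ η hη).1.1
    rw [div_mul_eq_mul_div, one_mul, div_le_iff₀ hC] at this
    linarith
  · refine ⟨by positivity, by positivity, fun t ht => ?_, fun x s hs t ht => ?_, fun x => ?_,
      fun x y => ?_⟩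
    · exact (hB.contDiff _ (hS.mapsTo θ η hη ht) _).continuous
    · choose! a ha using (h θ η hη).2.2 x
      exact (convex_Icc (0 : ℝ) 1).norm_image_sub_le_of_norm_hasDerivWithin_le
        (fun u hu => (ha u hu).1) (fun u hu => (ha u hu).2) hs ht
    · rw [geodesicField, hS.field_zero hη]; exact ((h θ η hη).2.1 x).1
    · rw [geodesicField, hS.field_zero hη]; exact hlip θ η hη x y

/-- Along the geodesics of `D` there are solution maps that transport the embedded measures, and
agree with the identity plus the initial velocity field to second order. -/
lemma exists_transport {Ω : Set (Eucl d)} (hΩ : IsCompact Ω)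
    (hS : IsParameterManifold S D) {E : M → Measure (Eucl d)}
    {B : ∀ θ : M, TangentSpace 𝓘(ℝ, F) θ →ₗ[ℝ] (Eucl d → Eucl d)} {C R : ℝ}
    (hB : HasFieldBounds D E B C) (hcons : IsConsistent Ω S E B) (hR0 : 0 ≤ R)
    (hR : ∀ (θ : M) (η : TangentSpace 𝓘(ℝ, F) θ),
      (⟨θ, η⟩ : TangentBundle 𝓘(ℝ, F) M) ∈ D → ‖η‖ ≤ R) :
    ∃ K : ℝ, 0 < K ∧ ∀ (θ : M) (η : TangentSpace 𝓘(ℝ, F) θ),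
      (⟨θ, η⟩ : TangentBundle 𝓘(ℝ, F) M) ∈ D → ∃ Φ : ℝ → Eucl d → Eucl d,
        IsSolutionMap Ω (geodesicField B θ η) Φ ∧
        (∀ t ∈ Icc (0 : ℝ) 1, E (expCurve θ η t) = (E θ).map (Φ t)) ∧
        ∀ x ∈ Ω, ‖Φ 1 x - x‖ ≤ K * ‖η‖ ∧ ‖Φ 1 x - x - B θ η x‖ ≤ K * ‖η‖ ^ 2 ∧
          ∀ t ∈ Icc (0 : ℝ) 1, ‖geodesicField B θ η t (Φ t x) - B θ η x‖ ≤ K * ‖η‖ ^ 2 := by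
  have hC := hB.pos
  -- The first summand controls the displacement, the bracket the second-order error; ‖η‖ ≤ R
  -- absorbs the excess power of ‖η‖ in each.
  refine ⟨C * (1 + R) + (C + C * (C * (1 + R))), by positivity, fun θ η hη => ?_⟩
  have htame := hB.tame θ η hη
  obtain ⟨Φ, hΦ⟩ := htame.exists_isSolutionMap hΩ
  have h0 : geodesicField B θ η 0 = B θ η := hS.field_zero hη B
  have hηR := hR θ η hη
  have hη0 : 0 ≤ ‖η‖ := norm_nonneg η
  have b1 : C * ‖η‖ + C * ‖η‖ ^ 2 ≤ C * (1 + R) * ‖η‖ := by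
    have : C * ‖η‖ * ‖η‖ ≤ C * ‖η‖ * R := by gcongr
    nlinarith
  have b2 : C * ‖η‖ ^ 2 + C * ‖η‖ * (C * ‖η‖ + C * ‖η‖ ^ 2) ≤
      (C + C * (C * (1 + R))) * ‖η‖ ^ 2 := by
    have : C * ‖η‖ * (C * ‖η‖ + C * ‖η‖ ^ 2) ≤ C * ‖η‖ * (C * (1 + R) * ‖η‖) := by gcongr
    nlinarith
  have b3 : C * (1 + R) * ‖η‖ ≤ (C * (1 + R) + (C + C * (C * (1 + R)))) * ‖η‖ := by
    exact mul_le_mul_of_nonneg_right (le_add_of_nonneg_right (by positivity)) hη0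
  have b4 : (C + C * (C * (1 + R))) * ‖η‖ ^ 2 ≤
      (C * (1 + R) + (C + C * (C * (1 + R)))) * ‖η‖ ^ 2 := by
    exact mul_le_mul_of_nonneg_right (le_add_of_nonneg_left (by positivity)) (sq_nonneg _)
  refine ⟨Φ, hΦ, fun t ht => ?_, fun x hx => ⟨?_, ?_, fun t ht => ?_⟩⟩
  · have h1 := hcons (expCurve θ η) (hS.isLipCurveOn_expCurve hη) Φ
      (hΦ.isFlow htame _) t ht
    rwa [hS.expCurve_zero hη] at h1
  · exact ((hΦ.norm_sub_init_le htame hx (t := 1) (by simp)).trans b1).trans b3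
  · have := hΦ.norm_displacement_sub_le htame hx
    rw [h0] at this
    exact (this.trans b2).trans b4
  · have := hΦ.norm_field_sub_init_le htame hx ht
    rw [h0] at this
    exact (this.trans b2).trans b4

end Geodesics

/-! ### Upper bound for one geodesic -/

section UpperBound

variable {d : ℕ}

lemma lintegral_enorm_sq_eq_eLpNorm_sq {α V : Type*} [MeasurableSpace α] [NormedAddCommGroup V]
    (f : α → V) (μ : Measure α) : ∫⁻ x, ‖f x‖ₑ ^ 2 ∂μ = eLpNorm f 2 μ ^ 2 := by
  have h := eLpNorm_nnreal_pow_eq_lintegral (f := f) (μ := μ) (p := 2) two_ne_zero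
  simpa using h.symm

lemma lintegral_enorm_sq_le_of_norm_le {α V W : Type*} [MeasurableSpace α]
    [NormedAddCommGroup V] [NormedAddCommGroup W] {μ : Measure α} [IsProbabilityMeasure μ]
    {f : α → V} {g : α → W} (hg : MemLp g 2 μ) {c : ℝ} (hc : 0 ≤ c)
    (h : ∀ᵐ x ∂μ, ‖f x‖ ≤ ‖g x‖ + c) :
    ∫⁻ x, ‖f x‖ₑ ^ 2 ∂μ ≤ ENNReal.ofReal (lpNorm g 2 μ + c) ^ 2 := by
  rw [lintegral_enorm_sq_eq_eLpNorm_sq]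
  gcongr
  calc eLpNorm f 2 μ ≤ eLpNorm ((fun x => ‖g x‖) + fun _ => c) 2 μ := eLpNorm_mono_ae_real h
    _ ≤ eLpNorm (fun x => ‖g x‖) 2 μ + eLpNorm (fun _ => c) 2 μ :=
        eLpNorm_add_le hg.1.norm aestronglyMeasurable_const (by norm_num)
    _ = ENNReal.ofReal (lpNorm g 2 μ + c) := by
        rw [eLpNorm_norm, ← ofReal_lpNorm hg, eLpNorm_const c two_ne_zero
          (IsProbabilityMeasure.ne_zero μ), ENNReal.ofReal_add lpNorm_nonneg hc]
        simp [← ofReal_norm, abs_of_nonneg hc]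

variable {F : Type*} [NormedAddCommGroup F] [NormedSpace ℝ F]
  {M : Type*} [TopologicalSpace M] [ChartedSpace F M]
  [RiemannianBundle (fun x : M => TangentSpace 𝓘(ℝ, F) x)]
  {S : Set M} {D : Set (TangentBundle 𝓘(ℝ, F) M)}
  {θ : M} {η : TangentSpace 𝓘(ℝ, F) θ}

/-- The curve of measures along a geodesic of `D` bounds the restricted distance from above. -/
lemma geodRestrEDist_exp_le {Ω : Set (Eucl d)} (hΩ : IsCompact Ω)
    (hS : IsParameterManifold S D) {E : M → Measure (Eucl d)}
    (hE : IsEmbeddingOn (F := F) Ω S E)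
    {B : ∀ θ : M, TangentSpace 𝓘(ℝ, F) θ →ₗ[ℝ] (Eucl d → Eucl d)} {C K : ℝ}
    (hB : HasFieldBounds D E B C) (hη : (⟨θ, η⟩ : TangentBundle 𝓘(ℝ, F) M) ∈ D)
    (hmem : MemLp (B θ η) 2 (E θ)) (hK : 0 ≤ K) {Φ : ℝ → Eucl d → Eucl d}
    (hΦ : IsSolutionMap Ω (geodesicField B θ η) Φ)
    (hE' : ∀ t ∈ Icc (0 : ℝ) 1, E (expCurve θ η t) = (E θ).map (Φ t))
    (hfield : ∀ x ∈ Ω, ∀ t ∈ Icc (0 : ℝ) 1,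
      ‖geodesicField B θ η t (Φ t x) - B θ η x‖ ≤ K * ‖η‖ ^ 2) :
    geodRestrEDist (E '' S) (E θ) (E (riemExp θ η)) ≤
      ENNReal.ofReal (lpNorm (B θ η) 2 (E θ) + K * ‖η‖ ^ 2) := by
  have hθ := hS.base_mem θ η hη
  have hprob := hE.isProbabilityMeasure θ hθ
  have htame := hB.tame θ η hη
  set c := lpNorm (B θ η) 2 (E θ) + K * ‖η‖ ^ 2 with hc
  let ρ : ℝ → Measure (Eucl d) := fun t => E (expCurve θ η t)
  have hlip : IsLipCurveIn (E '' S) ρ := by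
    obtain ⟨L, hL⟩ := hE.biLipschitz
    refine ⟨fun t ht => mem_image_of_mem E (hS.mapsTo θ η hη ht), L * ‖η‖₊, fun s hs t ht => ?_⟩
    refine (hL _ (hS.mapsTo θ η hη hs) _ (hS.mapsTo θ η hη ht)).1.trans ?_
    rw [ENNReal.coe_mul, mul_assoc]
    gcongr
    exact hS.intrinsicEDist_expCurve_le hη hs ht
  have henergy : energy ρ ≤ ENNReal.ofReal c ^ 2 := by
    -- The competitor is the field along the geodesic. Pulled back by Φ t, it stays within K‖η‖² of
    -- its initial value, so its L² norm is at most c at every time.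
    refine (iInf₂_le _ (hΦ.isContinuityEq hΩ htame (hE.concentrated θ hθ) hE')).trans ?_
    calc _ ≤ ∫⁻ _ in Icc (0 : ℝ) 1, ENNReal.ofReal c ^ 2 := by
          refine setLIntegral_mono measurable_const fun t ht => ?_
          have hm : Measurable fun x => ‖clampField (geodesicField B θ η) (t, x)‖ₑ ^ 2 :=
            (htame.continuous_clampField.measurable.comp measurable_prodMk_left).enorm.pow_const 2
          rw [show ρ t = (E θ).map (Φ t) from hE' t ht, lintegral_map hm (hΦ.measurable t)]
          refine lintegral_enorm_sq_le_of_norm_le hmem (by positivity) ?_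
          have hae : ∀ᵐ x ∂(E θ), x ∈ Ω := by rw [ae_iff]; exact hE.concentrated θ hθ
          filter_upwards [hae] with x hx
          rw [clampField_of_mem _ ht]
          exact (norm_le_norm_add_norm_sub' _ (B θ η x)).trans
            (add_le_add le_rfl (hfield x hx t ht))
      _ = ENNReal.ofReal c ^ 2 := by simp
  calc geodRestrEDist (E '' S) (E θ) (E (riemExp θ η)) ≤ energy ρ ^ (1 / 2 : ℝ) := by
        refine iInf₂_le_of_le ρ hlip (iInf₂_le_of_le ?_ ?_ le_rfl)
        · simp only [ρ, hS.expCurve_zero hη]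
        · simp only [ρ, expCurve, one_smul]
    _ ≤ (ENNReal.ofReal c ^ 2) ^ (1 / 2 : ℝ) := by gcongr
    _ = ENNReal.ofReal c := by
        rw [← ENNReal.rpow_natCast, ← ENNReal.rpow_mul]; norm_num

end UpperBound

/-! ### Lower bound for the energy by duality -/

section LowerBound

variable {d : ℕ}

/-- Kantorovich-type bound: integrals of Lipschitz functions are Lipschitz for `W`. -/
lemma edist_integral_le_wassEDist {f : Eucl d → ℝ} {ℓ : ℝ≥0} (hℓ : 0 < ℓ)
    (hf : LipschitzWith ℓ f) {μ ν : Measure (Eucl d)} [IsProbabilityMeasure μ]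
    (hμ : Integrable f μ) (hν : Integrable f ν) :
    edist (∫ x, f x ∂μ) (∫ x, f x ∂ν) ≤ ℓ * wassEDist μ ν := by
  have key : ∀ κ : Measure (Eucl d × Eucl d), κ.map Prod.fst = μ → κ.map Prod.snd = ν →
      edist (∫ x, f x ∂μ) (∫ x, f x ∂ν) ≤
        ℓ * (∫⁻ p, ‖p.1 - p.2‖ₑ ^ 2 ∂κ) ^ (1 / 2 : ℝ) := by
    intro κ h1 h2
    have hκ : IsProbabilityMeasure κ := by
      have : IsProbabilityMeasure (κ.map Prod.fst) := by rw [h1]; infer_instance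
      exact Measure.isProbabilityMeasure_of_map (f := Prod.fst)
    have hfm : Measurable f := hf.continuous.measurable
    have i1 : Integrable (fun p : Eucl d × Eucl d => f p.1) κ := by
      rw [← h1] at hμ
      exact hμ.comp_measurable measurable_fst
    have i2 : Integrable (fun p : Eucl d × Eucl d => f p.2) κ := by
      rw [← h2] at hν
      exact hν.comp_measurable measurable_snd
    have e1 : ∫ x, f x ∂μ = ∫ p, f p.1 ∂κ := by
      rw [← h1, integral_map measurable_fst.aemeasurable hfm.aestronglyMeasurable]
    have e2 : ∫ x, f x ∂ν = ∫ p, f p.2 ∂κ := by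
      rw [← h2, integral_map measurable_snd.aemeasurable hfm.aestronglyMeasurable]
    rw [e1, e2, edist_eq_enorm_sub, ← integral_sub i1 i2]
    calc ‖∫ p, (f p.1 - f p.2) ∂κ‖ₑ ≤ ∫⁻ p, ‖f p.1 - f p.2‖ₑ ∂κ := enorm_integral_le_lintegral_enorm _
      _ ≤ ∫⁻ p, ℓ * ‖p.1 - p.2‖ₑ ∂κ := by
          refine lintegral_mono fun p => ?_
          rw [← edist_eq_enorm_sub, ← edist_eq_enorm_sub]
          exact hf p.1 p.2
      _ = ℓ * eLpNorm (fun p : Eucl d × Eucl d => p.1 - p.2) 1 κ := by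
          rw [lintegral_const_mul _ (by fun_prop), eLpNorm_one_eq_lintegral_enorm]
      _ ≤ ℓ * eLpNorm (fun p : Eucl d × Eucl d => p.1 - p.2) 2 κ := by
          gcongr
          exact eLpNorm_le_eLpNorm_of_exponent_le (by norm_num)
            (Measurable.aestronglyMeasurable (by fun_prop))
      _ = ℓ * (∫⁻ p, ‖p.1 - p.2‖ₑ ^ 2 ∂κ) ^ (1 / 2 : ℝ) := by
          rw [lintegral_enorm_sq_eq_eLpNorm_sq, ← ENNReal.rpow_natCast, ← ENNReal.rpow_mul]
          norm_num
  have hℓ0 : (ℓ : ℝ≥0∞) ≠ 0 := by exact_mod_cast hℓ.ne'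
  -- Dividing by ℓ and squaring removes everything around the infimum over couplings, so the bound
  -- can be checked coupling by coupling.
  rw [mul_comm, ← ENNReal.div_le_iff hℓ0 ENNReal.coe_ne_top, wassEDist,
    ← ENNReal.rpow_le_rpow_iff (z := 2) (by norm_num), ← ENNReal.rpow_mul]
  norm_num
  intro κ h1 h2
  have h := key κ h1 h2
  rw [mul_comm, ← ENNReal.div_le_iff hℓ0 ENNReal.coe_ne_top,
    ← ENNReal.rpow_le_rpow_iff (z := 2) (by norm_num), ← ENNReal.rpow_mul] at h
  norm_num at h
  exact h

lemma ofReal_integral_le_lintegral_ofReal {α : Type*} [MeasurableSpace α] {μ : Measure α}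
    {f : α → ℝ} (hf : Integrable f μ) :
    ENNReal.ofReal (∫ x, f x ∂μ) ≤ ∫⁻ x, ENNReal.ofReal (f x) ∂μ := by
  calc ENNReal.ofReal (∫ x, f x ∂μ) ≤ ENNReal.ofReal (∫ x, max (f x) 0 ∂μ) :=
        ENNReal.ofReal_le_ofReal (integral_mono hf hf.pos_part fun x => le_max_left _ _)
    _ = ∫⁻ x, ENNReal.ofReal (max (f x) 0) ∂μ :=
        ofReal_integral_eq_lintegral_ofReal hf.pos_part
          (Filter.Eventually.of_forall fun x => le_max_right _ _)
    _ = ∫⁻ x, ENNReal.ofReal (f x) ∂μ := by simp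

/-- Duality estimate for the energy: a potential `ψ` with gradient `p` gives, through the
subsolution `ψ - (κ/2) t |p|²` of the Hamilton–Jacobi equation, a lower bound for the kinetic
energy of any solution of the continuity equation. -/
lemma ofReal_dual_le_kinetic {p : Eucl d → Eucl d} {ψ : Eucl d → ℝ}
    (hψ : ∀ x, HasGradientAt ψ (p x) x) (hp : ContDiff ℝ 1 p) {A L : ℝ}
    (hA : ∀ x, ‖p x‖ ≤ A) (hL : ∀ x y, ‖p x - p y‖ ≤ L * ‖x - y‖) (hL0 : 0 ≤ L)
    (hL8 : L ≤ 1 / 8) {ρ : ℝ → Measure (Eucl d)}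
    (hρ : ∀ t ∈ Icc (0 : ℝ) 1, IsProbabilityMeasure (ρ t)) {k : ℝ≥0}
    (hρk : ∀ s ∈ Icc (0 : ℝ) 1, ∀ t ∈ Icc (0 : ℝ) 1, wassEDist (ρ s) (ρ t) ≤ k * edist s t)
    (hψ1 : Integrable ψ (ρ 1)) {v : ℝ → Eucl d → Eucl d}
    (hv : IsContinuityEq ρ v) :
    ENNReal.ofReal (2 * (∫ x, ψ x ∂(ρ 1) - ∫ x, ψ x ∂(ρ 0)) -
      (1 + 8 * L) * ∫ x, ‖p x‖ ^ 2 ∂(ρ 1)) ≤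
      ∫⁻ t in Icc (0 : ℝ) 1, ∫⁻ x, ‖v t x‖ₑ ^ 2 ∂(ρ t) := by
  set κ := 1 + 8 * L with hκ
  -- This inequality dictates κ = 1 + 8L: for L ≤ 1/8 one has κ ≤ 2, and (1 + 2L)² ≤ 1 + 8L.
  have hκL : (1 + κ * L) ^ 2 ≤ κ := by
    have h1 : κ * L ≤ 2 * L := by gcongr; linarith
    have h2 : 0 ≤ κ * L := mul_nonneg (by rw [hκ]; positivity) hL0
    nlinarith
  have hκ0 : 0 ≤ κ := by positivity
  have hA0 : 0 ≤ A := (norm_nonneg _).trans (hA 0)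
  have hψd : ∀ x, HasFDerivAt ψ (InnerProductSpace.toDual ℝ (Eucl d) (p x)) x := hψ
  have hpd : ∀ x, HasFDerivAt p (fderiv ℝ p x) x := fun x =>
    (hp.differentiable one_ne_zero).differentiableAt.hasFDerivAt
  have hDp : ∀ x w, ‖fderiv ℝ p x w‖ ≤ L * ‖w‖ := by
    intro x w
    refine ((fderiv ℝ p x).le_opNorm w).trans ?_
    gcongr
    refine norm_fderiv_le_of_lip' ℝ hL0 (Filter.Eventually.of_forall fun y => hL y x)
  have hψC : ContDiff ℝ 1 ψ := by
    rw [contDiff_one_iff_fderiv]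
    refine ⟨fun x => (hψd x).differentiableAt, ?_⟩
    have : fderiv ℝ ψ = fun x => InnerProductSpace.toDual ℝ (Eucl d) (p x) :=
      funext fun x => (hψd x).fderiv
    rw [this]
    exact (InnerProductSpace.toDual ℝ (Eucl d)).continuous.comp hp.continuous
  let φ : ℝ × Eucl d → ℝ := fun q => ψ q.2 - κ / 2 * q.1 * ‖p q.2‖ ^ 2
  have hφ : ContDiff ℝ 1 φ := by
    have h1 : ContDiff ℝ 1 fun q : ℝ × Eucl d => ‖p q.2‖ ^ 2 := (hp.comp contDiff_snd).norm_sq ℝ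
    exact (hψC.comp contDiff_snd).sub ((contDiff_const.mul contDiff_fst).mul h1)
  have hdt : ∀ t x, deriv (fun s => φ (s, x)) t = -(κ / 2) * ‖p x‖ ^ 2 := by
    intro t x
    have h1 : HasDerivAt (fun s => φ (s, x)) (0 - κ / 2 * 1 * ‖p x‖ ^ 2) t :=
      (hasDerivAt_const t (ψ x)).sub (((hasDerivAt_id t).const_mul (κ / 2)).mul_const (‖p x‖ ^ 2))
    rw [h1.deriv]; ring
  -- The spatial gradient of φ has norm at most (1 + κL)|p|, so Young's inequality and the choice of
  -- κ apply. The term (κ/2)|p|² cancels the time derivative of φ, leaving half the kinetic energy.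
  have hgrad : ∀ t ∈ Icc (0 : ℝ) 1, ∀ x w,
      inner ℝ (gradient (fun y => φ (t, y)) x) w ≤ 1 / 2 * ‖w‖ ^ 2 + κ / 2 * ‖p x‖ ^ 2 := by
    intro t ht x w
    have h1 : HasFDerivAt (fun y => φ (t, y)) (InnerProductSpace.toDual ℝ (Eucl d) (p x) -
        (κ / 2 * t) • (2 • (innerSL ℝ (p x)).comp (fderiv ℝ p x))) x :=
      (hψd x).sub ((hpd x).norm_sq.const_mul (κ / 2 * t))
    have h2 : inner ℝ (gradient (fun y => φ (t, y)) x) w =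
        inner ℝ (p x) w - κ * t * inner ℝ (p x) (fderiv ℝ p x w) := by
      rw [gradient, h1.fderiv, InnerProductSpace.toDual_symm_apply]
      simp
      ring
    have h3 : inner ℝ (p x) w ≤ ‖p x‖ * ‖w‖ := real_inner_le_norm _ _
    have h4 : |inner ℝ (p x) (fderiv ℝ p x w)| ≤ ‖p x‖ * (L * ‖w‖) :=
      (abs_real_inner_le_norm _ _).trans (by gcongr; exact hDp x w)
    have h5 : -(κ * t * inner ℝ (p x) (fderiv ℝ p x w)) ≤ κ * (‖p x‖ * (L * ‖w‖)) := by
      have h6 : |κ * t * inner ℝ (p x) (fderiv ℝ p x w)| ≤ κ * 1 * (‖p x‖ * (L * ‖w‖)) := by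
        rw [abs_mul, abs_of_nonneg (mul_nonneg hκ0 ht.1)]
        gcongr
        exact ht.2
      linarith [neg_abs_le (κ * t * inner ℝ (p x) (fderiv ℝ p x w))]
    have h7 : inner ℝ (gradient (fun y => φ (t, y)) x) w ≤ (1 + κ * L) * ‖p x‖ * ‖w‖ := by
      rw [h2]; linarith
    have h8 : (1 + κ * L) ^ 2 * ‖p x‖ ^ 2 ≤ κ * ‖p x‖ ^ 2 := by gcongr
    nlinarith [sq_nonneg ((1 + κ * L) * ‖p x‖ - ‖w‖)]
  have hpint : ∀ t ∈ Icc (0 : ℝ) 1, Integrable (fun x => ‖p x‖ ^ 2) (ρ t) := by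
    intro t ht
    have := hρ t ht
    refine Integrable.of_bound (hp.continuous.norm.pow 2).aestronglyMeasurable (A ^ 2)
      (Filter.Eventually.of_forall fun x => ?_)
    rw [Real.norm_of_nonneg (by positivity)]
    have := hA x
    gcongr
  let g : ℝ → ℝ := fun t => ∫ x, ‖p x‖ ^ 2 ∂(ρ t)
  let H : ℝ → ℝ := fun t => ∫ x, inner ℝ (gradient (fun y => φ (t, y)) x) (v t x) ∂(ρ t)
  have hg0 : ∀ t, 0 ≤ g t := fun t => integral_nonneg fun x => by positivity
  -- |p|² is Lipschitz because p is bounded and Lipschitz, so its integral is continuous along a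
  -- curve Lipschitz for W. The + 1 in ℓ only ensures positivity.
  have hgc : ContinuousOn g (Icc 0 1) := by
    let ℓ : ℝ≥0 := (2 * A * L + 1).toNNReal
    have hℓ : 0 < ℓ := Real.toNNReal_pos.2 (by positivity)
    have hlip : LipschitzWith ℓ fun x => ‖p x‖ ^ 2 := by
      refine LipschitzWith.of_dist_le_mul fun x y => ?_
      rw [Real.coe_toNNReal _ (by positivity), Real.dist_eq, dist_eq_norm]
      have h1 : ‖p x‖ ^ 2 - ‖p y‖ ^ 2 = (‖p x‖ + ‖p y‖) * (‖p x‖ - ‖p y‖) := by ring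
      have h2 : |‖p x‖ - ‖p y‖| ≤ L * ‖x - y‖ := (abs_norm_sub_norm_le _ _).trans (hL x y)
      rw [h1, abs_mul, abs_of_nonneg (by positivity)]
      calc (‖p x‖ + ‖p y‖) * |‖p x‖ - ‖p y‖| ≤ (A + A) * (L * ‖x - y‖) := by
            gcongr
            · exact hA x
            · exact hA y
        _ ≤ (2 * A * L + 1) * ‖x - y‖ := by nlinarith [norm_nonneg (x - y)]
    have : LipschitzOnWith (ℓ * k) g (Icc 0 1) := by
      intro s hs t ht
      have := hρ s hs
      refine (edist_integral_le_wassEDist hℓ hlip (hpint s hs) (hpint t ht)).trans ?_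
      rw [ENNReal.coe_mul, mul_assoc]
      gcongr
      exact hρk s hs t ht
    exact this.continuousOn
  have hgI : IntervalIntegrable g volume 0 1 := by
    refine ContinuousOn.intervalIntegrable ?_
    rwa [uIcc_of_le zero_le_one]
  have hHle : ∀ t ∈ Icc (0 : ℝ) 1,
      ENNReal.ofReal (2 * H t - κ * g t) ≤ ∫⁻ x, ‖v t x‖ₑ ^ 2 ∂(ρ t) := by
    intro t ht
    have hvt := hv.memLp t ht
    have hvi : Integrable (fun x => ‖v t x‖ ^ 2) (ρ t) := hvt.integrable_norm_pow two_ne_zero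
    have h1 : H t ≤ ∫ x, (1 / 2 * ‖v t x‖ ^ 2 + κ / 2 * ‖p x‖ ^ 2) ∂(ρ t) := by
      -- If the integrand is not integrable, the Bochner integral is 0 by convention, and the bound
      -- holds since its right side is nonnegative.
      by_cases hi : Integrable (fun x => inner ℝ (gradient (fun y => φ (t, y)) x) (v t x)) (ρ t)
      · exact integral_mono hi ((hvi.const_mul _).add ((hpint t ht).const_mul _))
          fun x => hgrad t ht x (v t x)
      · simp only [H]
        rw [integral_undef hi]
        exact integral_nonneg fun x => by positivity
    rw [integral_add (hvi.const_mul _) ((hpint t ht).const_mul _), integral_const_mul,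
      integral_const_mul] at h1
    have h2 : 2 * H t - κ * g t ≤ ∫ x, ‖v t x‖ ^ 2 ∂(ρ t) := by
      simp only [g]; linarith
    refine (ENNReal.ofReal_le_ofReal h2).trans ?_
    rw [ofReal_integral_eq_lintegral_ofReal hvi (Filter.Eventually.of_forall fun x => by positivity)]
    refine lintegral_mono fun x => ?_
    rw [ENNReal.ofReal_pow (norm_nonneg _), ofReal_norm]
  have hce := hv.eq φ hφ
  have e1 : (∫ t in (0 : ℝ)..1, ∫ x, deriv (fun s => φ (s, x)) t ∂(ρ t)) =
      -(κ / 2) * ∫ t in (0 : ℝ)..1, g t := by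
    simp only [hdt, integral_const_mul, g, intervalIntegral.integral_const_mul]
  have e2 : ∫ x, φ (1, x) ∂(ρ 1) = ∫ x, ψ x ∂(ρ 1) - κ / 2 * ∫ x, ‖p x‖ ^ 2 ∂(ρ 1) := by
    simp only [φ, mul_one]
    rw [integral_sub hψ1 ((hpint 1 (by simp)).const_mul _), integral_const_mul]
  have e3 : ∫ x, φ (0, x) ∂(ρ 0) = ∫ x, ψ x ∂(ρ 0) := by simp [φ]
  rw [e1, e2, e3] at hce
  have e4 : 2 * (∫ x, ψ x ∂(ρ 1) - ∫ x, ψ x ∂(ρ 0)) - κ * ∫ x, ‖p x‖ ^ 2 ∂(ρ 1) =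
      2 * (∫ t in (0 : ℝ)..1, H t) - κ * ∫ t in (0 : ℝ)..1, g t := by
    simp only [H]; linarith
  rw [e4]
  -- If H is not integrable in time, its integral is 0 by convention and the dual value is
  -- nonpositive, so nothing is left to prove.
  by_cases hHI : IntervalIntegrable H volume 0 1
  · rw [← intervalIntegral.integral_const_mul, ← intervalIntegral.integral_const_mul,
      ← intervalIntegral.integral_sub (hHI.const_mul _) (hgI.const_mul _),
      intervalIntegral.integral_of_le zero_le_one, ← integral_Icc_eq_integral_Ioc]
    have hI : IntegrableOn (fun t => 2 * H t - κ * g t) (Icc 0 1) := by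
      rw [← intervalIntegrable_iff_integrableOn_Icc_of_le zero_le_one]
      exact (hHI.const_mul _).sub (hgI.const_mul _)
    refine (ofReal_integral_le_lintegral_ofReal hI).trans ?_
    refine lintegral_mono_ae ?_
    filter_upwards [ae_restrict_mem measurableSet_Icc] with t ht using hHle t ht
  · rw [intervalIntegral.integral_undef hHI]
    have : 0 ≤ κ * ∫ t in (0 : ℝ)..1, g t :=
      mul_nonneg hκ0 (intervalIntegral.integral_nonneg zero_le_one fun t _ => hg0 t)
    rw [ENNReal.ofReal_of_nonpos (by linarith)]
    exact zero_le

end LowerBound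

/-! ### Two facts on L² norms -/

section LpNorm

variable {α V : Type*} [MeasurableSpace α] [NormedAddCommGroup V] {μ : Measure α}

lemma lpNorm_two_sq {f : α → V} (hf : MemLp f 2 μ) :
    lpNorm f 2 μ ^ 2 = ∫ x, ‖f x‖ ^ 2 ∂μ := by
  rw [lpNorm_eq_integral_norm_rpow_toReal two_ne_zero (by norm_num) hf.1]
  simp only [ENNReal.toReal_ofNat, Real.rpow_two]
  rw [← Real.rpow_natCast, ← Real.rpow_mul (integral_nonneg fun x => by positivity)]
  norm_num

lemma lpNorm_two_le_add_of_norm_sub_le [IsProbabilityMeasure μ] {f g : α → V} (hf : MemLp f 2 μ)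
    (hg : MemLp g 2 μ) {c : ℝ} (hc : 0 ≤ c) (h : ∀ᵐ x ∂μ, ‖f x - g x‖ ≤ c) :
    lpNorm f 2 μ ≤ lpNorm g 2 μ + c := by
  have h1 := lintegral_enorm_sq_le_of_norm_le (f := f) hg hc (by
    filter_upwards [h] with x hx
    exact (norm_le_norm_add_norm_sub' _ (g x)).trans (add_le_add le_rfl hx))
  rw [lintegral_enorm_sq_eq_eLpNorm_sq, ← ofReal_lpNorm hf] at h1
  have h2 := (ENNReal.pow_le_pow_left_iff two_ne_zero).1 h1
  exact (ENNReal.ofReal_le_ofReal_iff (add_nonneg lpNorm_nonneg hc)).1 h2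

end LpNorm

/-! ### Expansions of potentials along maps close to the identity -/

section GradientFields

variable {d : ℕ}

/-- Second order Taylor estimate for a potential with Lipschitz gradient. -/
lemma abs_potential_sub_inner_le {p : Eucl d → Eucl d} {ψ : Eucl d → ℝ}
    (hψ : ∀ x, HasGradientAt ψ (p x) x) {L r : ℝ} (hL0 : 0 ≤ L)
    (hL : ∀ x y, ‖p x - p y‖ ≤ L * ‖x - y‖) {x y z : Eucl d} (hx : ‖x - z‖ ≤ r)
    (hy : ‖y - z‖ ≤ r) : |ψ y - ψ x - inner ℝ (p z) (y - x)| ≤ L * r * ‖y - x‖ := by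
  -- After subtracting the linear part at z, the gradient is at most L r on the ball, and the mean
  -- value inequality applies.
  have hd : ∀ u ∈ Metric.closedBall z r, HasFDerivWithinAt (fun u => ψ u - inner ℝ (p z) u)
      (InnerProductSpace.toDual ℝ (Eucl d) (p u) - InnerProductSpace.toDual ℝ (Eucl d) (p z))
      (Metric.closedBall z r) u := by
    intro u _
    have h1 : HasFDerivAt ψ (InnerProductSpace.toDual ℝ (Eucl d) (p u)) u := hψ u
    exact (h1.sub (InnerProductSpace.toDual ℝ (Eucl d) (p z)).hasFDerivAt).hasFDerivWithinAt
  have h := (convex_closedBall z r).norm_image_sub_le_of_norm_hasFDerivWithin_le hd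
    (C := L * r) (fun u hu => by
      rw [← map_sub, LinearIsometryEquiv.norm_map]
      refine (hL u z).trans (mul_le_mul_of_nonneg_left ?_ hL0)
      rwa [← dist_eq_norm])
    (show x ∈ Metric.closedBall z r by rwa [Metric.mem_closedBall, dist_eq_norm])
    (show y ∈ Metric.closedBall z r by rwa [Metric.mem_closedBall, dist_eq_norm])
  rw [Real.norm_eq_abs] at h
  convert h using 2
  rw [inner_sub_right]; ring

lemma integrable_of_concentrated {Ω : Set (Eucl d)} (hΩ : IsCompact Ω) {μ : Measure (Eucl d)}
    [IsFiniteMeasure μ] (hμ : μ Ωᶜ = 0) {f : Eucl d → ℝ} (hf : Continuous f) :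
    Integrable f μ := by
  obtain ⟨c, hc⟩ := hΩ.exists_bound_of_continuousOn hf.continuousOn
  refine Integrable.of_bound hf.aestronglyMeasurable c ?_
  have hae : ∀ᵐ x ∂μ, x ∈ Ω := by rwa [ae_iff]
  filter_upwards [hae] with x hx using hc x hx

lemma continuous_of_hasGradientAt {p : Eucl d → Eucl d} {ψ : Eucl d → ℝ}
    (hψ : ∀ x, HasGradientAt ψ (p x) x) : Continuous ψ :=
  continuous_iff_continuousAt.2 fun x => (hψ x).continuousAt

/-- If two maps close to the identity push `μ` to the same measure, and their difference is close
to a gradient field, then this gradient field is small in `L²(μ)`. -/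
lemma lpNorm_gradient_le_of_map_eq {μ : Measure (Eucl d)} [IsProbabilityMeasure μ]
    {w : Eucl d → Eucl d} {u : Eucl d → ℝ} (hu : ∀ x, HasGradientAt u (w x) x) {ℓ r ε : ℝ}
    (hℓ0 : 0 ≤ ℓ) (hr0 : 0 ≤ r) (hε0 : 0 ≤ ε) (hw : ∀ x y, ‖w x - w y‖ ≤ ℓ * ‖x - y‖)
    (hw2 : MemLp w 2 μ) {X Y : Eucl d → Eucl d} (hX : Measurable X) (hY : Measurable Y)
    (hXY : μ.map X = μ.map Y) (hui : Integrable u (μ.map X))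
    (hXr : ∀ᵐ x ∂μ, ‖X x - x‖ ≤ r) (hYr : ∀ᵐ x ∂μ, ‖Y x - x‖ ≤ r)
    (hε : ∀ᵐ x ∂μ, ‖X x - Y x - w x‖ ≤ ε) :
    lpNorm w 2 μ ≤ 2 * (ε + ℓ * r) := by
  have hiX : Integrable (fun x => u (X x)) μ := hui.comp_measurable hX
  have hiY : Integrable (fun x => u (Y x)) μ := by
    rw [hXY] at hui; exact hui.comp_measurable hY
  have heq : ∫ x, u (X x) ∂μ = ∫ x, u (Y x) ∂μ := by
    have hum := (continuous_of_hasGradientAt hu).measurable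
    rw [← integral_map hX.aemeasurable hum.aestronglyMeasurable, hXY,
      integral_map hY.aemeasurable hum.aestronglyMeasurable]
  -- Taylor expansion at x gives u(X) - u(Y) ≥ |w|² - (ε + ℓr)|w| - ℓrε. Young's inequality absorbs
  -- the linear term into half of |w|². The difference of u then integrates to zero, as both maps
  -- have the same image measure.
  have hpt : ∀ᵐ x ∂μ, ‖w x‖ ^ 2 ≤ 2 * (u (X x) - u (Y x)) + 2 * (ε + ℓ * r) ^ 2 := by
    filter_upwards [hXr, hYr, hε] with x h1 h2 h3
    have h4 := abs_potential_sub_inner_le hu hℓ0 hw h2 h1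
    have h5 : inner ℝ (w x) (X x - Y x) = ‖w x‖ ^ 2 + inner ℝ (w x) (X x - Y x - w x) := by
      rw [inner_sub_right (w x) (X x - Y x), real_inner_self_eq_norm_sq]; ring
    have h6 : |inner ℝ (w x) (X x - Y x - w x)| ≤ ‖w x‖ * ε :=
      (abs_real_inner_le_norm _ _).trans (by gcongr)
    have h7 : ‖X x - Y x‖ ≤ ‖w x‖ + ε :=
      (norm_le_norm_add_norm_sub' _ (w x)).trans (add_le_add le_rfl h3)
    have h8 : ℓ * r * ‖X x - Y x‖ ≤ ℓ * r * (‖w x‖ + ε) := by gcongr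
    have h9 := neg_abs_le (inner ℝ (w x) (X x - Y x - w x))
    have h10 := neg_abs_le (u (X x) - u (Y x) - inner ℝ (w x) (X x - Y x))
    have h11 : 0 ≤ ℓ * r := mul_nonneg hℓ0 hr0
    nlinarith [sq_nonneg (‖w x‖ - (ε + ℓ * r)), mul_nonneg h11 hε0, mul_nonneg hε0 hε0,
      mul_nonneg h11 h11]
  have hdiff : Integrable (fun x => 2 * (u (X x) - u (Y x))) μ := (hiX.sub hiY).const_mul 2
  have hint : ∫ x, ‖w x‖ ^ 2 ∂μ ≤ 2 * (ε + ℓ * r) ^ 2 := by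
    calc ∫ x, ‖w x‖ ^ 2 ∂μ ≤ ∫ x, (2 * (u (X x) - u (Y x)) + 2 * (ε + ℓ * r) ^ 2) ∂μ :=
          integral_mono_ae (hw2.integrable_norm_pow two_ne_zero)
            (hdiff.add (integrable_const _)) hpt
      _ = 2 * (ε + ℓ * r) ^ 2 := by
          rw [integral_add hdiff (integrable_const _), integral_const_mul,
            integral_sub hiX hiY, heq]
          simp
  rw [← lpNorm_two_sq hw2] at hint
  have h0 : 0 ≤ ε + ℓ * r := by positivity
  refine abs_le_of_sq_le_sq' (a := lpNorm w 2 μ) ?_ (by positivity) |>.2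
  nlinarith [sq_nonneg (ε + ℓ * r)]

/-- Pointwise lower bound for the integrand of the dual functional. -/
lemma dual_integrand_ge {p : Eucl d → Eucl d} {ψ : Eucl d → ℝ}
    (hψ : ∀ x, HasGradientAt ψ (p x) x) {C K h : ℝ} (hC : 0 ≤ C) (hK : 0 ≤ K) (hh0 : 0 ≤ h)
    (hsmall : C * h ≤ 1 / 8) (hA : ∀ x, ‖p x‖ ≤ C * h)
    (hL : ∀ x y, ‖p x - p y‖ ≤ C * h * ‖x - y‖) {T : Eucl d → Eucl d} {x : Eucl d}
    (d1 : ‖T x - x‖ ≤ K * h) (d2 : ‖T x - x - p x‖ ≤ K * h ^ 2) :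
    ‖p x‖ ^ 2 - (2 * C * K + 3 * C * K ^ 2 + 8 * C ^ 3 + 4 * C ^ 2 * K) * h ^ 3 ≤
      2 * (ψ (T x) - ψ x) - (1 + 8 * (C * h)) * ‖p (T x)‖ ^ 2 := by
  have t1 := abs_potential_sub_inner_le hψ (by positivity) hL (x := x) (y := T x) (z := x)
    (r := K * h) (by simpa using by positivity) d1
  have t2 : inner ℝ (p x) (T x - x) = ‖p x‖ ^ 2 + inner ℝ (p x) (T x - x - p x) := by
    rw [inner_sub_right (p x) (T x - x), real_inner_self_eq_norm_sq]; ring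
  have t3 : |inner ℝ (p x) (T x - x - p x)| ≤ C * h * (K * h ^ 2) :=
    (abs_real_inner_le_norm _ _).trans (by gcongr; exact hA x)
  have t4 : C * h * (K * h) * ‖T x - x‖ ≤ C * h * (K * h) * (K * h) := by gcongr
  have t5 := neg_abs_le (inner ℝ (p x) (T x - x - p x))
  have t6 := neg_abs_le (ψ (T x) - ψ x - inner ℝ (p x) (T x - x))
  have t7 : ψ (T x) - ψ x ≥ ‖p x‖ ^ 2 - C * K * h ^ 3 - C * K ^ 2 * h ^ 3 := by nlinarith
  have s1 : ‖p (T x)‖ ≤ ‖p x‖ + C * h * (K * h) :=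
    (norm_le_norm_add_norm_sub' _ (p x)).trans
      (add_le_add le_rfl ((hL _ _).trans (by gcongr)))
  have s2 : ‖p (T x)‖ ^ 2 ≤ ‖p x‖ ^ 2 + (2 * C ^ 2 * K + C * K ^ 2 / 8) * h ^ 3 := by
    have s3 : ‖p (T x)‖ ^ 2 ≤ (‖p x‖ + C * h * (K * h)) ^ 2 := by gcongr
    have s4 : ‖p x‖ * (C * h * (K * h)) ≤ C * h * (C * h * (K * h)) := by
      gcongr; exact hA x
    have s5 : C * h * (C * h * (K * h) * (K * h)) ≤ 1 / 8 * (C * h * (K * h) * (K * h)) := by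
      gcongr
    nlinarith
  have s6 : C * h * ‖p (T x)‖ ^ 2 ≤ C * h * ‖p x‖ ^ 2 +
      1 / 8 * ((2 * C ^ 2 * K + C * K ^ 2 / 8) * h ^ 3) := by
    have s7 : C * h * ‖p (T x)‖ ^ 2 ≤ C * h * (‖p x‖ ^ 2 +
      (2 * C ^ 2 * K + C * K ^ 2 / 8) * h ^ 3) := by gcongr
    have s8 : C * h * ((2 * C ^ 2 * K + C * K ^ 2 / 8) * h ^ 3) ≤
      1 / 8 * ((2 * C ^ 2 * K + C * K ^ 2 / 8) * h ^ 3) := by gcongr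
    linarith
  have s9 : C * h * ‖p x‖ ^ 2 ≤ C ^ 3 * h ^ 3 := by
    have : C * h * ‖p x‖ ^ 2 ≤ C * h * (C * h) ^ 2 := by gcongr; exact hA x
    linarith [this, show C * h * (C * h) ^ 2 = C ^ 3 * h ^ 3 by ring]
  have s10 : 0 ≤ C * K ^ 2 * h ^ 3 := by positivity
  nlinarith

/-- To leading order ψ(T x) - ψ(x) is |p|², and |p|² changes only at third order under T, so the
dual value is 2|p|² - |p|² integrated. Both integrals over the image measure are pulled back by T
and the pointwise bound is integrated. -/
lemma dual_value_ge {μ : Measure (Eucl d)} [IsProbabilityMeasure μ] {p : Eucl d → Eucl d}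
    {ψ : Eucl d → ℝ} (hψ : ∀ x, HasGradientAt ψ (p x) x) {C K h : ℝ} (hC : 0 ≤ C) (hK : 0 ≤ K)
    (hh0 : 0 ≤ h) (hsmall : C * h ≤ 1 / 8) (hA : ∀ x, ‖p x‖ ≤ C * h)
    (hL : ∀ x y, ‖p x - p y‖ ≤ C * h * ‖x - y‖) (hp : Continuous p) {T : Eucl d → Eucl d}
    (hT : Measurable T) (hT1 : ∀ᵐ x ∂μ, ‖T x - x‖ ≤ K * h)
    (hT2 : ∀ᵐ x ∂μ, ‖T x - x - p x‖ ≤ K * h ^ 2) (hψ0 : Integrable ψ μ)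
    (hψ1 : Integrable ψ (μ.map T)) :
    lpNorm p 2 μ ^ 2 - (2 * C * K + 3 * C * K ^ 2 + 8 * C ^ 3 + 4 * C ^ 2 * K) * h ^ 3 ≤
      2 * (∫ x, ψ x ∂(μ.map T) - ∫ x, ψ x ∂μ) -
        (1 + 8 * (C * h)) * ∫ x, ‖p x‖ ^ 2 ∂(μ.map T) := by
  have hψc := continuous_of_hasGradientAt hψ
  have hmem : MemLp p 2 μ := MemLp.of_bound hp.aestronglyMeasurable _ (.of_forall hA)
  have hpc : Continuous fun x => ‖p x‖ ^ 2 := hp.norm.pow 2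
  have hψT : Integrable (fun x => ψ (T x)) μ := hψ1.comp_measurable hT
  have hpT : Integrable (fun x => ‖p (T x)‖ ^ 2) μ := by
    have : MemLp (fun x => p (T x)) 2 μ :=
      MemLp.of_bound (hp.measurable.comp hT).aestronglyMeasurable _ (.of_forall fun x => hA (T x))
    exact this.integrable_norm_pow two_ne_zero
  have hdiff : Integrable (fun x => 2 * (ψ (T x) - ψ x)) μ := (hψT.sub hψ0).const_mul 2
  have hpi : Integrable (fun x => ‖p x‖ ^ 2) μ := hmem.integrable_norm_pow two_ne_zero
  set c := (2 * C * K + 3 * C * K ^ 2 + 8 * C ^ 3 + 4 * C ^ 2 * K) * h ^ 3 with hc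
  have e1 : ∫ x, ‖p x‖ ^ 2 ∂μ - c = ∫ x, (‖p x‖ ^ 2 - c) ∂μ := by
    rw [integral_sub hpi (integrable_const _)]
    simp
  rw [integral_map hT.aemeasurable hψc.aestronglyMeasurable,
    integral_map hT.aemeasurable hpc.aestronglyMeasurable, ← integral_sub hψT hψ0,
    ← integral_const_mul, ← integral_const_mul, ← integral_sub hdiff (hpT.const_mul _),
    lpNorm_two_sq hmem, e1]
  refine integral_mono_ae (hpi.sub (integrable_const _)) (hdiff.sub (hpT.const_mul _)) ?_
  filter_upwards [hT1, hT2] with x d1 d2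
  exact dual_integrand_ge hψ hC hK hh0 hsmall hA hL d1 d2

/-- For 0 ≤ a ≤ P one has (P - a)² ≤ P² - aP, and h ≤ C P makes aP at least K₃h³. The part 8C² of
the coefficient is not needed here; it serves the case of large h in `le_geodRestrEDist_exp`. -/
lemma max_sub_sq_le {C K₃ h P : ℝ} (hC : 0 ≤ C) (hK₃0 : 0 ≤ K₃) (hP0 : 0 ≤ P)
    (hPl : h ≤ C * P) :
    (max (P - (8 * C ^ 2 + C * K₃) * h ^ 2) 0) ^ 2 ≤ max (P ^ 2 - K₃ * h ^ 3) 0 := by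
  rcases le_total (P - (8 * C ^ 2 + C * K₃) * h ^ 2) 0 with h1 | h1
  · rw [max_eq_right h1]; simp
  · rw [max_eq_left h1]
    refine le_max_of_le_left ?_
    have a1 : 0 ≤ (8 * C ^ 2 + C * K₃) * h ^ 2 := by positivity
    have a2 : (8 * C ^ 2 + C * K₃) * h ^ 2 * ((8 * C ^ 2 + C * K₃) * h ^ 2) ≤
        (8 * C ^ 2 + C * K₃) * h ^ 2 * P := by gcongr; linarith
    have a3 : K₃ * h ^ 2 * h ≤ K₃ * h ^ 2 * (C * P) := by gcongr
    have a4 : 0 ≤ 8 * C ^ 2 * h ^ 2 * P := by positivity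
    nlinarith

end GradientFields

/-! ### Lower bound for one geodesic -/

section Comparison

variable {d : ℕ} {F : Type*} [NormedAddCommGroup F] [NormedSpace ℝ F]
  {M : Type*} [TopologicalSpace M] [ChartedSpace F M]
  [RiemannianBundle (fun x : M => TangentSpace 𝓘(ℝ, F) x)]
  {S : Set M} {D : Set (TangentBundle 𝓘(ℝ, F) M)}
  {θ : M} {η : TangentSpace 𝓘(ℝ, F) θ}

lemma memLp_field (hS : IsParameterManifold S D) {E : M → Measure (Eucl d)}
    {B : ∀ θ : M, TangentSpace 𝓘(ℝ, F) θ →ₗ[ℝ] (Eucl d → Eucl d)} {C : ℝ}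
    (hB : IsVelocityFamily S D E B) (hBC : HasFieldBounds D E B C)
    (hη : (⟨θ, η⟩ : TangentBundle 𝓘(ℝ, F) M) ∈ D) (μ : Measure (Eucl d)) [IsFiniteMeasure μ] :
    MemLp (B θ η) 2 μ :=
  MemLp.of_bound (hB.contDiff θ (hS.base_mem θ η hη) η).continuous.aestronglyMeasurable
    (C * ‖η‖) (Filter.Eventually.of_forall (hBC.norm_le θ η hη))

/-- The restricted distance between the ends of a geodesic of `D` is bounded from below, to second
order, by the length of the initial velocity field. -/
lemma le_geodRestrEDist_exp {Ω : Set (Eucl d)} (hΩ : IsCompact Ω)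
    (hS : IsParameterManifold S D) {E : M → Measure (Eucl d)}
    (hE : IsEmbeddingOn (F := F) Ω S E)
    {B : ∀ θ : M, TangentSpace 𝓘(ℝ, F) θ →ₗ[ℝ] (Eucl d → Eucl d)} {C K : ℝ}
    (hB : IsVelocityFamily S D E B) (hBC : HasFieldBounds D E B C)
    (hη : (⟨θ, η⟩ : TangentBundle 𝓘(ℝ, F) M) ∈ D) (hK : 0 ≤ K) {T : Eucl d → Eucl d}
    (hT : Measurable T) (hTE : E (riemExp θ η) = (E θ).map T)
    (hT1 : ∀ x ∈ Ω, ‖T x - x‖ ≤ K * ‖η‖)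
    (hT2 : ∀ x ∈ Ω, ‖T x - x - B θ η x‖ ≤ K * ‖η‖ ^ 2) :
    ENNReal.ofReal (lpNorm (B θ η) 2 (E θ) - (8 * C ^ 2 +
      C * (2 * C * K + 3 * C * K ^ 2 + 8 * C ^ 3 + 4 * C ^ 2 * K)) * ‖η‖ ^ 2) ≤
      geodRestrEDist (E '' S) (E θ) (E (riemExp θ η)) := by
  set K₃ := 2 * C * K + 3 * C * K ^ 2 + 8 * C ^ 3 + 4 * C ^ 2 * K with hK₃
  set h := ‖η‖ with hh
  set P := lpNorm (B θ η) 2 (E θ) with hP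
  have hC := hBC.pos
  have hh0 : 0 ≤ h := norm_nonneg η
  have hK₃0 : 0 ≤ K₃ := by positivity
  have hPu : P ≤ C * h := hBC.upper θ η hη
  have hPl : h ≤ C * P := hBC.lower θ η hη
  -- For C h > 1/8 the bound is void: P ≤ C h ≤ 8C²h², so the left side is zero.
  by_cases hsmall : C * h ≤ 1 / 8
  swap
  · rw [ENNReal.ofReal_of_nonpos]
    · exact zero_le
    · have h1 : 1 ≤ 8 * (C * h) := by linarith
      have h2 : C * h * 1 ≤ C * h * (8 * (C * h)) := by gcongr
      have h3 : 0 ≤ C * K₃ * h ^ 2 := by positivity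
      nlinarith
  have hθ := hS.base_mem θ η hη
  have hprob := hE.isProbabilityMeasure θ hθ
  have hprob' := hE.isProbabilityMeasure _ (hS.exp_mem hη)
  obtain ⟨ψ, hψ⟩ := hB.isGradient θ hθ η
  have hp := hB.contDiff θ hθ η
  have hA := hBC.norm_le θ η hη
  have hL := hBC.lip θ η hη
  have hmem := memLp_field hS hB hBC hη (E θ)
  set p := B θ η with hpdef
  have hψc := continuous_of_hasGradientAt hψ
  have hψ0 : Integrable ψ (E θ) := integrable_of_concentrated hΩ (hE.concentrated θ hθ) hψc
  have hψ1 : Integrable ψ (E (riemExp θ η)) :=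
    integrable_of_concentrated hΩ (hE.concentrated _ (hS.exp_mem hη)) hψc
  have hae : ∀ᵐ x ∂(E θ), x ∈ Ω := by rw [ae_iff]; exact hE.concentrated θ hθ
  have hQ := dual_value_ge hψ hC.le hK hh0 hsmall hA hL hp.continuous hT
    (hae.mono fun x hx => hT1 x hx) (hae.mono fun x hx => hT2 x hx) hψ0 (by rwa [← hTE])
  rw [← hTE, ← hK₃] at hQ
  have hmain := max_sub_sq_le hC.le hK₃0 lpNorm_nonneg hPl
  refine le_iInf₂ fun ρ hρ => le_iInf₂ fun h0 h1 => ?_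
  obtain ⟨hρS, k, hρk⟩ := hρ
  have henergy : ENNReal.ofReal (P - (8 * C ^ 2 + C * K₃) * h ^ 2) ^ 2 ≤ energy ρ := by
    refine le_iInf₂ fun v hv => ?_
    -- Of membership in Λ only the fact that each ρ t is a probability measure is used.
    have hdual := ofReal_dual_le_kinetic hψ hp hA hL (by positivity) hsmall (ρ := ρ)
      (fun t ht => by
        obtain ⟨θ', hθ', he⟩ := hρS t ht
        rw [← he]; exact hE.isProbabilityMeasure θ' hθ') hρk (by rwa [h1]) hv
    rw [h0, h1] at hdual
    refine le_trans ?_ ((ENNReal.ofReal_le_ofReal hQ).trans hdual)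
    have e1 : ∀ y : ℝ, ENNReal.ofReal y = ENNReal.ofReal (max y 0) := fun y => by simp
    rw [e1 (P - _), e1 (P ^ 2 - _), ← ENNReal.ofReal_pow (le_max_right _ _)]
    exact ENNReal.ofReal_le_ofReal hmain
  calc ENNReal.ofReal (P - (8 * C ^ 2 + C * K₃) * h ^ 2) =
        (ENNReal.ofReal (P - (8 * C ^ 2 + C * K₃) * h ^ 2) ^ 2) ^ (1 / 2 : ℝ) := by
        rw [← ENNReal.rpow_natCast, ← ENNReal.rpow_mul]; norm_num
    _ ≤ energy ρ ^ (1 / 2 : ℝ) := by gcongr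

end Comparison

/-! ### Geodesic triangles and the linearization estimate -/

section MainEstimate

variable {d : ℕ} {F : Type*} [NormedAddCommGroup F] [NormedSpace ℝ F]
  {M : Type*} [TopologicalSpace M] [ChartedSpace F M]
  [RiemannianBundle (fun x : M => TangentSpace 𝓘(ℝ, F) x)]
  {S : Set M} {D : Set (TangentBundle 𝓘(ℝ, F) M)}

/-- The maps transporting the embedded measures along the geodesics of `D`. -/
def HasTransport (Ω : Set (Eucl d)) (D : Set (TangentBundle 𝓘(ℝ, F) M))
    (E : M → Measure (Eucl d))
    (B : ∀ θ : M, TangentSpace 𝓘(ℝ, F) θ →ₗ[ℝ] (Eucl d → Eucl d)) (K : ℝ) : Prop :=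
  ∀ (θ : M) (η : TangentSpace 𝓘(ℝ, F) θ), (⟨θ, η⟩ : TangentBundle 𝓘(ℝ, F) M) ∈ D →
    ∃ T : Eucl d → Eucl d, Measurable T ∧ E (riemExp θ η) = (E θ).map T ∧
      ∀ x ∈ Ω, ‖T x - x‖ ≤ K * ‖η‖ ∧ ‖T x - x - B θ η x‖ ≤ K * ‖η‖ ^ 2

/-- To second order, the restricted distance between the ends of a geodesic of `D` is the length
of the initial velocity field. -/
lemma exists_abs_geodRestrEDist_exp_sub_le {Ω : Set (Eucl d)} (hΩ : IsCompact Ω)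
    (hS : IsParameterManifold S D) {E : M → Measure (Eucl d)}
    (hE : IsEmbeddingOn (F := F) Ω S E)
    {B : ∀ θ : M, TangentSpace 𝓘(ℝ, F) θ →ₗ[ℝ] (Eucl d → Eucl d)} {C : ℝ}
    (hB : IsVelocityFamily S D E B) (hBC : HasFieldBounds D E B C)
    (hcons : IsConsistent Ω S E B) :
    ∃ K K' : ℝ, 0 ≤ K ∧ 0 ≤ K' ∧ HasTransport Ω D E B K ∧
      ∀ (θ : M) (η : TangentSpace 𝓘(ℝ, F) θ), (⟨θ, η⟩ : TangentBundle 𝓘(ℝ, F) M) ∈ D →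
        geodRestrEDist (E '' S) (E θ) (E (riemExp θ η)) ≠ ⊤ ∧
        |(geodRestrEDist (E '' S) (E θ) (E (riemExp θ η))).toReal - lpNorm (B θ η) 2 (E θ)| ≤
          K' * ‖η‖ ^ 2 := by
  obtain ⟨R, hR0, hR⟩ := hS.exists_norm_le hΩ hE
  obtain ⟨K, hK, htr⟩ := exists_transport hΩ hS hBC hcons hR0 hR
  have hC := hBC.pos
  set K'' := 8 * C ^ 2 + C * (2 * C * K + 3 * C * K ^ 2 + 8 * C ^ 3 + 4 * C ^ 2 * K) with hK''
  have hK''0 : 0 ≤ K'' := by positivity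
  refine ⟨K, K + K'', hK.le, by positivity, fun θ η hη => ?_, fun θ η hη => ?_⟩
  · obtain ⟨Φ, hΦ, hΦE, hΦb⟩ := htr θ η hη
    refine ⟨Φ 1, hΦ.measurable 1, ?_, fun x hx => ⟨(hΦb x hx).1, (hΦb x hx).2.1⟩⟩
    simpa [expCurve] using hΦE 1 (by simp)
  · obtain ⟨Φ, hΦ, hΦE, hΦb⟩ := htr θ η hη
    have := hE.isProbabilityMeasure θ (hS.base_mem θ η hη)
    have hmem := memLp_field hS hB hBC hη (E θ)
    have hup := geodRestrEDist_exp_le hΩ hS hE hBC hη hmem hK.le hΦ hΦE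
      fun x hx => (hΦb x hx).2.2
    have hlo := le_geodRestrEDist_exp hΩ hS hE hB hBC hη hK.le (hΦ.measurable 1)
      (by simpa [expCurve] using hΦE 1 (by simp)) (fun x hx => (hΦb x hx).1)
      fun x hx => (hΦb x hx).2.1
    rw [← hK''] at hlo
    have hne := ne_top_of_le_ne_top ENNReal.ofReal_ne_top hup
    have hη2 : 0 ≤ ‖η‖ ^ 2 := by positivity
    refine ⟨hne, abs_le.2 ⟨?_, ?_⟩⟩
    · have h1 := (ENNReal.ofReal_le_iff_le_toReal hne).1 hlo
      nlinarith
    · have h1 := ENNReal.toReal_le_of_le_ofReal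
        (add_nonneg lpNorm_nonneg (by positivity)) hup
      nlinarith

/-- Comparison of the velocity fields on the three sides of a small geodesic triangle. -/
lemma lpNorm_triangle_defect_le {Ω : Set (Eucl d)} (hΩ : IsCompact Ω)
    (hS : IsParameterManifold S D) {E : M → Measure (Eucl d)}
    (hE : IsEmbeddingOn (F := F) Ω S E)
    {B : ∀ θ : M, TangentSpace 𝓘(ℝ, F) θ →ₗ[ℝ] (Eucl d → Eucl d)} {C K A : ℝ}
    (hB : IsVelocityFamily S D E B) (hBC : HasFieldBounds D E B C) (hK : 0 ≤ K) (hA : 0 ≤ A)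
    {θ : M} {η₁ η₂ : TangentSpace 𝓘(ℝ, F) θ}
    (h₁ : (⟨θ, η₁⟩ : TangentBundle 𝓘(ℝ, F) M) ∈ D) (h₂ : (⟨θ, η₂⟩ : TangentBundle 𝓘(ℝ, F) M) ∈ D)
    {ζ : TangentSpace 𝓘(ℝ, F) (riemExp θ η₁)}
    (hζ : (⟨riemExp θ η₁, ζ⟩ : TangentBundle 𝓘(ℝ, F) M) ∈ D)
    (hζe : riemExp (riemExp θ η₁) ζ = riemExp θ η₂) (hζA : ‖ζ‖ ≤ A * (‖η₁‖ + ‖η₂‖))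
    {T₁ T₂ T₃ : Eucl d → Eucl d} (hT₁ : Measurable T₁) (hT₂ : Measurable T₂) (hT₃ : Measurable T₃)
    (hE₁ : E (riemExp θ η₁) = (E θ).map T₁) (hE₂ : E (riemExp θ η₂) = (E θ).map T₂)
    (hE₃ : E (riemExp (riemExp θ η₁) ζ) = (E (riemExp θ η₁)).map T₃)
    (hT₁' : ∀ x ∈ Ω, ‖T₁ x - x‖ ≤ K * ‖η₁‖ ∧ ‖T₁ x - x - B θ η₁ x‖ ≤ K * ‖η₁‖ ^ 2)
    (hT₂' : ∀ x ∈ Ω, ‖T₂ x - x‖ ≤ K * ‖η₂‖ ∧ ‖T₂ x - x - B θ η₂ x‖ ≤ K * ‖η₂‖ ^ 2)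
    (hT₃' : ∀ x ∈ Ω, ‖T₃ x - x‖ ≤ K * ‖ζ‖ ∧
      ‖T₃ x - x - B (riemExp θ η₁) ζ x‖ ≤ K * ‖ζ‖ ^ 2) :
    lpNorm (fun x => B θ η₂ x - B θ η₁ x - B (riemExp θ η₁) ζ x) 2 (E θ) ≤
      2 * ((K + K * A ^ 2 + C * A * K) + C * (1 + A) * (K * (1 + A))) *
        (‖η₁‖ + ‖η₂‖) ^ 2 := by
  have hC := hBC.pos
  have hθ := hS.base_mem θ η₁ h₁
  have hθ₁ := hS.exp_mem h₁
  have hθ₂ := hS.exp_mem h₂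
  have hprob := hE.isProbabilityMeasure θ hθ
  have hprob₂ := hE.isProbabilityMeasure _ hθ₂
  obtain ⟨ψ₁, hψ₁⟩ := hB.isGradient θ hθ η₁
  obtain ⟨ψ₂, hψ₂⟩ := hB.isGradient θ hθ η₂
  obtain ⟨χ, hχ⟩ := hB.isGradient _ hθ₁ ζ
  set τ := ‖η₁‖ + ‖η₂‖ with hτ
  have n1 : 0 ≤ ‖η₁‖ := norm_nonneg _
  have n2 : 0 ≤ ‖η₂‖ := norm_nonneg _
  have n3 : 0 ≤ ‖ζ‖ := norm_nonneg _
  have hτ0 : 0 ≤ τ := add_nonneg n1 n2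
  have n1τ : ‖η₁‖ ≤ τ := le_add_of_nonneg_right n2
  have n2τ : ‖η₂‖ ≤ τ := le_add_of_nonneg_left n1
  have hae : ∀ᵐ x ∂(E θ), x ∈ Ω := by rw [ae_iff]; exact hE.concentrated θ hθ
  have hae₁ : ∀ᵐ x ∂(E θ), T₁ x ∈ Ω := by
    have h : ∀ᵐ y ∂((E θ).map T₁), y ∈ Ω := by
      rw [ae_iff, ← hE₁]; exact hE.concentrated _ hθ₁
    exact ae_of_ae_map hT₁.aemeasurable h
  have hu : ∀ x, HasGradientAt (fun y => ψ₂ y - ψ₁ y - χ y)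
      (B θ η₂ x - B θ η₁ x - B (riemExp θ η₁) ζ x) x := by
    intro x
    have a1 : HasFDerivAt ψ₁ _ x := hψ₁ x
    have a2 : HasFDerivAt ψ₂ _ x := hψ₂ x
    have a3 : HasFDerivAt χ _ x := hχ x
    rw [hasGradientAt_iff_hasFDerivAt, map_sub, map_sub]
    exact (a2.sub a1).sub a3
  -- Both ways around the triangle end at the same measure.
  have hXY : (E θ).map T₂ = (E θ).map (fun x => T₃ (T₁ x)) := by
    rw [← hE₂, ← hζe, hE₃, hE₁, Measure.map_map hT₃ hT₁]; rfl
  have m1 := memLp_field hS hB hBC h₁ (E θ)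
  have m2 := memLp_field hS hB hBC h₂ (E θ)
  have m3 := memLp_field hS hB hBC hζ (E θ)
  have key := lpNorm_gradient_le_of_map_eq hu (ℓ := C * (1 + A) * τ) (r := K * (1 + A) * τ)
    (ε := (K + K * A ^ 2 + C * A * K) * τ ^ 2) (by positivity) (by positivity) (by positivity)
    (fun x y => by
      have b1 := hBC.lip θ η₁ h₁ x y
      have b2 := hBC.lip θ η₂ h₂ x y
      have b3 := hBC.lip _ ζ hζ x y
      have e : B θ η₂ x - B θ η₁ x - B (riemExp θ η₁) ζ x -
          (B θ η₂ y - B θ η₁ y - B (riemExp θ η₁) ζ y) = (B θ η₂ x - B θ η₂ y) -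
          (B θ η₁ x - B θ η₁ y) - (B (riemExp θ η₁) ζ x - B (riemExp θ η₁) ζ y) := by abel
      rw [e]
      refine (norm_sub_le _ _).trans ((add_le_add (norm_sub_le _ _) le_rfl).trans ?_)
      have b4 : C * ‖ζ‖ * ‖x - y‖ ≤ C * (A * τ) * ‖x - y‖ := by gcongr
      have b5 : C * (1 + A) * τ * ‖x - y‖ = C * ‖η₂‖ * ‖x - y‖ + C * ‖η₁‖ * ‖x - y‖ +
        C * (A * τ) * ‖x - y‖ := by rw [hτ]; ring
      linarith)
    ((m2.sub m1).sub m3) hT₂ (hT₃.comp hT₁) hXY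
    (by
      rw [← hE₂]
      exact integrable_of_concentrated hΩ (hE.concentrated _ hθ₂) (continuous_of_hasGradientAt hu))
    (by
      filter_upwards [hae] with x hx
      refine (hT₂' x hx).1.trans ?_
      have : K * ‖η₂‖ ≤ K * τ := by gcongr
      have : 0 ≤ K * A * τ := by positivity
      linarith)
    (by
      filter_upwards [hae, hae₁] with x hx hx₁
      have c1 : ‖T₃ (T₁ x) - x‖ ≤ ‖T₃ (T₁ x) - T₁ x‖ + ‖T₁ x - x‖ :=
        norm_sub_le_norm_sub_add_norm_sub _ _ _
      have c2 := (hT₃' _ hx₁).1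
      have c3 := (hT₁' x hx).1
      have c4 : K * ‖ζ‖ ≤ K * (A * τ) := by gcongr
      have c5 : K * ‖η₁‖ ≤ K * τ := by gcongr
      simp only [Function.comp_apply]
      linarith)
    (by
      filter_upwards [hae, hae₁] with x hx hx₁
      have c1 := (hT₁' x hx).2
      have c2 := (hT₂' x hx).2
      have c3 := (hT₃' _ hx₁).2
      have c4 : ‖B (riemExp θ η₁) ζ (T₁ x) - B (riemExp θ η₁) ζ x‖ ≤
          C * (A * τ) * (K * τ) := by
        refine (hBC.lip _ ζ hζ (T₁ x) x).trans ?_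
        have := (hT₁' x hx).1.trans (mul_le_mul_of_nonneg_left n1τ hK)
        gcongr
      have c5 : K * ‖ζ‖ ^ 2 ≤ K * (A * τ) ^ 2 := by gcongr
      have c6 : K * ‖η₁‖ ^ 2 + K * ‖η₂‖ ^ 2 ≤ K * τ ^ 2 := by
        have : 0 ≤ K * (‖η₁‖ * ‖η₂‖) := by positivity
        rw [hτ]; nlinarith
      have e : T₂ x - T₃ (T₁ x) - (B θ η₂ x - B θ η₁ x - B (riemExp θ η₁) ζ x) =
          (T₂ x - x - B θ η₂ x) - (T₁ x - x - B θ η₁ x) -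
          (T₃ (T₁ x) - T₁ x - B (riemExp θ η₁) ζ (T₁ x)) -
          (B (riemExp θ η₁) ζ (T₁ x) - B (riemExp θ η₁) ζ x) := by abel
      simp only [Function.comp_apply]
      rw [e]
      have t1 := norm_sub_le (T₂ x - x - B θ η₂ x) (T₁ x - x - B θ η₁ x)
      have t2 := norm_sub_le ((T₂ x - x - B θ η₂ x) - (T₁ x - x - B θ η₁ x))
        (T₃ (T₁ x) - T₁ x - B (riemExp θ η₁) ζ (T₁ x))
      have t3 := norm_sub_le ((T₂ x - x - B θ η₂ x) - (T₁ x - x - B θ η₁ x) -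
        (T₃ (T₁ x) - T₁ x - B (riemExp θ η₁) ζ (T₁ x)))
        (B (riemExp θ η₁) ζ (T₁ x) - B (riemExp θ η₁) ζ x)
      nlinarith)
  refine key.trans_eq ?_
  ring

/-- The local linearization estimate: up to second order, the restricted distance between
`λ_{exp η₁}` and `λ_{exp η₂}` is the `L²` distance of the velocity fields of `η₁` and `η₂`. -/
theorem exists_abs_geodRestrEDist_sub_le {Ω : Set (Eucl d)} (hΩ : IsCompact Ω)
    (hS : IsParameterManifold S D) {E : M → Measure (Eucl d)}
    (hE : IsEmbeddingOn (F := F) Ω S E)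
    {B : ∀ θ : M, TangentSpace 𝓘(ℝ, F) θ →ₗ[ℝ] (Eucl d → Eucl d)}
    (hB : IsVelocityFamily S D E B) (hcons : IsConsistent Ω S E B) :
    ∃ C : ℝ, 0 < C ∧ ∀ (θ : M) (η₁ η₂ : TangentSpace 𝓘(ℝ, F) θ),
      (⟨θ, η₁⟩ : TangentBundle 𝓘(ℝ, F) M) ∈ D → (⟨θ, η₂⟩ : TangentBundle 𝓘(ℝ, F) M) ∈ D →
        geodRestrEDist (E '' S) (E (riemExp θ η₁)) (E (riemExp θ η₂)) ≠ ⊤ ∧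
        |(geodRestrEDist (E '' S) (E (riemExp θ η₁)) (E (riemExp θ η₂))).toReal -
          lpNorm (B θ (η₁ - η₂)) 2 (E θ)| ≤ C * (‖η₁‖ + ‖η₂‖) ^ 2 := by
  obtain ⟨C, hBC⟩ := hB.exists_hasFieldBounds hS
  obtain ⟨K, K', hK, hK', htr, hexp⟩ := exists_abs_geodRestrEDist_exp_sub_le hΩ hS hE hB hBC hcons
  obtain ⟨L, hL⟩ := hE.biLipschitz
  have hC := hBC.pos
  set A : ℝ := L * K with hA
  have hA0 : 0 ≤ A := by positivity
  set G : ℝ := 2 * ((K + K * A ^ 2 + C * A * K) + C * (1 + A) * (K * (1 + A))) with hG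
  have hG0 : 0 ≤ G := by positivity
  -- The summands come from the estimate along ζ, from moving the L² norm of Bζ from λ at exp η₁ to
  -- λ_θ, and from the triangle defect; the 1 ensures positivity.
  refine ⟨K' * A ^ 2 + C * A * K + G + 1, by positivity, fun θ η₁ η₂ h₁ h₂ => ?_⟩
  have hθ := hS.base_mem θ η₁ h₁
  have hθ₁ := hS.exp_mem h₁
  have hθ₂ := hS.exp_mem h₂
  have hprob := hE.isProbabilityMeasure θ hθ
  have hprob₁ := hE.isProbabilityMeasure _ hθ₁
  have hae : ∀ᵐ x ∂(E θ), x ∈ Ω := by rw [ae_iff]; exact hE.concentrated θ hθ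
  obtain ⟨ζ, hζ, hζe⟩ := hS.exists_exp_eq _ hθ₁ _ hθ₂
  obtain ⟨T₁, hT₁, hE₁, hT₁'⟩ := htr θ η₁ h₁
  obtain ⟨T₂, hT₂, hE₂, hT₂'⟩ := htr θ η₂ h₂
  obtain ⟨T₃, hT₃, hE₃, hT₃'⟩ := htr _ ζ hζ
  set τ := ‖η₁‖ + ‖η₂‖ with hτ
  have n1 : 0 ≤ ‖η₁‖ := norm_nonneg _
  have n2 : 0 ≤ ‖η₂‖ := norm_nonneg _
  have hτ0 : 0 ≤ τ := add_nonneg n1 n2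
  have n1τ : ‖η₁‖ ≤ τ := le_add_of_nonneg_right n2
  -- ‖ζ‖ is the intrinsic distance of the endpoints, hence at most L times their Wasserstein
  -- distance, which the coupling (T₁, T₂) bounds by Kτ.
  have hζA : ‖ζ‖ ≤ A * τ := by
    have h1 : ‖ζ‖ₑ ≤ L * ENNReal.ofReal (K * τ) := by
      rw [hS.minimizing _ ζ hζ, hζe]
      refine (hL _ hθ₁ _ hθ₂).2.trans ?_
      gcongr
      rw [hE₁, hE₂]
      refine wassEDist_map_le hT₁ hT₂ ?_
      filter_upwards [hae] with x hx
      have c1 := (hT₁' x hx).1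
      have c2 := (hT₂' x hx).1
      calc ‖T₁ x - T₂ x‖ = ‖(T₁ x - x) - (T₂ x - x)‖ := by congr 1; abel
        _ ≤ ‖T₁ x - x‖ + ‖T₂ x - x‖ := norm_sub_le _ _
        _ ≤ K * τ := by rw [hτ]; linarith
    rw [← ofReal_norm, ← ENNReal.ofReal_coe_nnreal, ← ENNReal.ofReal_mul (by positivity)] at h1
    have h2 := (ENNReal.ofReal_le_ofReal_iff (by positivity)).1 h1
    rw [hA, mul_assoc]; exact h2
  have hw := lpNorm_triangle_defect_le hΩ hS hE hB hBC hK hA0 h₁ h₂ hζ hζe hζA hT₁ hT₂ hT₃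
    hE₁ hE₂ hE₃ hT₁' hT₂' hT₃'
  rw [← hτ, ← hG] at hw
  obtain ⟨hfin, hdist⟩ := hexp _ ζ hζ
  rw [hζe] at hfin hdist
  refine ⟨hfin, ?_⟩
  set q := B (riemExp θ η₁) ζ with hq
  have m1 := memLp_field hS hB hBC h₁ (E θ)
  have m2 := memLp_field hS hB hBC h₂ (E θ)
  have m3 : MemLp q 2 (E θ) := memLp_field hS hB hBC hζ (E θ)
  have m4 : MemLp q 2 ((E θ).map T₁) := by
    rw [← hE₁]; exact memLp_field hS hB hBC hζ _
  have m5 : MemLp (q ∘ T₁) 2 (E θ) := m4.comp_of_map hT₁.aemeasurable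
  have e1 : lpNorm q 2 (E (riemExp θ η₁)) = lpNorm (q ∘ T₁) 2 (E θ) := by
    rw [hE₁, ← toReal_eLpNorm m4.1, ← toReal_eLpNorm m5.1,
      eLpNorm_map_measure m4.1 hT₁.aemeasurable]
  have hqT : ∀ᵐ x ∂(E θ), ‖q (T₁ x) - q x‖ ≤ C * A * K * τ ^ 2 := by
    filter_upwards [hae] with x hx
    refine (hBC.lip _ ζ hζ (T₁ x) x).trans ?_
    have := (hT₁' x hx).1.trans (mul_le_mul_of_nonneg_left n1τ hK)
    calc C * ‖ζ‖ * ‖T₁ x - x‖ ≤ C * (A * τ) * (K * τ) := by gcongr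
      _ = C * A * K * τ ^ 2 := by ring
  have q1 := lpNorm_two_le_add_of_norm_sub_le m5 m3 (by positivity) hqT
  have q2 := lpNorm_two_le_add_of_norm_sub_le m3 m5 (c := C * A * K * τ ^ 2) (by positivity)
    (hqT.mono fun x hx => by rwa [norm_sub_rev])
  have m12 : MemLp (B θ η₂ - B θ η₁) 2 (E θ) := m2.sub m1
  have e2 : lpNorm (B θ (η₁ - η₂)) 2 (E θ) = lpNorm (B θ η₂ - B θ η₁) 2 (E θ) := by
    rw [map_sub, lpNorm_sub_comm]
  have hw' : lpNorm (B θ η₂ - B θ η₁ - q) 2 (E θ) ≤ G * τ ^ 2 := hw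
  have w1 := lpNorm_le_lpNorm_add_lpNorm_sub' (f := B θ η₂ - B θ η₁) m3 (by norm_num)
  have w2 := lpNorm_le_lpNorm_add_lpNorm_sub (f := q) m12 (by norm_num)
  have k1 : K' * ‖ζ‖ ^ 2 ≤ K' * A ^ 2 * τ ^ 2 := by
    calc K' * ‖ζ‖ ^ 2 ≤ K' * (A * τ) ^ 2 := by gcongr
      _ = K' * A ^ 2 * τ ^ 2 := by ring
  rw [e1] at hdist
  rw [e2]
  have hτ2 : 0 ≤ τ ^ 2 := by positivity
  obtain ⟨l1, l2⟩ := abs_le.1 hdist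
  rw [abs_le]
  constructor <;> nlinarith

end MainEstimate

end WassersteinSubmanifold

end

/-- Since D is star-shaped, the linearization estimate applies to tη₁, tη₂, and linearity of B_θ
extracts the factor t. The error is O(t²) on all of [0,1], with the value 0 at t = 0, which gives
the one-sided derivative. -/
theorem mainTheorem1
    {d : ℕ}
    {F : Type*} [NormedAddCommGroup F] [NormedSpace ℝ F] [FiniteDimensional ℝ F]
    {M : Type*} [TopologicalSpace M] [T2Space M]
    [ChartedSpace F M]
    [IsManifold 𝓘(ℝ, F) ∞ M]
    [RiemannianBundle (fun x : M => TangentSpace 𝓘(ℝ, F) x)]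
    [IsContMDiffRiemannianBundle 𝓘(ℝ, F) ∞ F (fun x : M => TangentSpace 𝓘(ℝ, F) x)]
    (Ω : Set (WassersteinSubmanifold.Eucl d)) (hΩc : IsCompact Ω) (hΩ : Convex ℝ Ω)
    (S : Set M) (D : Set (TangentBundle 𝓘(ℝ, F) M))
    (hS : WassersteinSubmanifold.IsParameterManifold S D)
    (E : M → Measure (WassersteinSubmanifold.Eucl d))
    (hE : WassersteinSubmanifold.IsEmbeddingOn (F := F) Ω S E)
    (B : ∀ θ : M, TangentSpace 𝓘(ℝ, F) θ →ₗ[ℝ]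
      (WassersteinSubmanifold.Eucl d → WassersteinSubmanifold.Eucl d))
    (hB : WassersteinSubmanifold.IsVelocityFamily S D E B)
    (hcons : WassersteinSubmanifold.IsConsistent Ω S E B) :
    ∃ C : ℝ, 0 < C ∧
      ∀ (θ : M) (η₁ η₂ : TangentSpace 𝓘(ℝ, F) θ),
        (⟨θ, η₁⟩ : TangentBundle 𝓘(ℝ, F) M) ∈ D → (⟨θ, η₂⟩ : TangentBundle 𝓘(ℝ, F) M) ∈ D →
        -- `W_Λ` is finite along the two curves, so that its real value is meaningful
        (∀ t ∈ Icc (0 : ℝ) 1,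
          WassersteinSubmanifold.geodRestrEDist (E '' S)
            (E (WassersteinSubmanifold.expCurve θ η₁ t))
            (E (WassersteinSubmanifold.expCurve θ η₂ t)) ≠ ⊤) ∧
        -- `0 ≤ t < min {1, 1 / (C ‖η₁‖), 1 / (C ‖η₂‖)}`, where `1 / 0 = ∞`
        (∀ t : ℝ, 0 ≤ t → t < 1 → t * (C * ‖η₁‖) < 1 → t * (C * ‖η₂‖) < 1 →
          |(WassersteinSubmanifold.geodRestrEDist (E '' S)
              (E (WassersteinSubmanifold.expCurve θ η₁ t))
              (E (WassersteinSubmanifold.expCurve θ η₂ t))).toReal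
            - t * lpNorm (B θ (η₁ - η₂)) 2 (E θ)|
          ≤ t ^ 2 * C * (‖η₁‖ + ‖η₂‖) ^ 2) ∧
        HasDerivWithinAt
          (fun t : ℝ => (WassersteinSubmanifold.geodRestrEDist (E '' S)
            (E (WassersteinSubmanifold.expCurve θ η₁ t))
            (E (WassersteinSubmanifold.expCurve θ η₂ t))).toReal)
          (lpNorm (B θ (η₁ - η₂)) 2 (E θ)) (Icc 0 1) 0 := by
  obtain ⟨C, hC, hmain⟩ :=
    WassersteinSubmanifold.exists_abs_geodRestrEDist_sub_le hΩc hS hE hB hcons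
  refine ⟨C, hC, fun θ η₁ η₂ h₁ h₂ => ?_⟩
  have key : ∀ t ∈ Icc (0 : ℝ) 1,
      WassersteinSubmanifold.geodRestrEDist (E '' S)
        (E (WassersteinSubmanifold.expCurve θ η₁ t))
        (E (WassersteinSubmanifold.expCurve θ η₂ t)) ≠ ⊤ ∧
      |(WassersteinSubmanifold.geodRestrEDist (E '' S)
        (E (WassersteinSubmanifold.expCurve θ η₁ t))
        (E (WassersteinSubmanifold.expCurve θ η₂ t))).toReal
          - t * lpNorm (B θ (η₁ - η₂)) 2 (E θ)| ≤ t ^ 2 * C * (‖η₁‖ + ‖η₂‖) ^ 2 := by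
    intro t ht
    obtain ⟨hf, hb⟩ := hmain θ (t • η₁) (t • η₂) (hS.smul_mem θ η₁ h₁ t ht)
      (hS.smul_mem θ η₂ h₂ t ht)
    refine ⟨hf, ?_⟩
    rw [← smul_sub, map_smul, lpNorm_const_smul, norm_smul, norm_smul, coe_nnnorm,
      Real.norm_of_nonneg ht.1] at hb
    refine hb.trans_eq ?_
    ring
  refine ⟨fun t ht => (key t ht).1, fun t h0 h1 _ _ => (key t ⟨h0, h1.le⟩).2, ?_⟩
  set f : ℝ → ℝ := fun t => (WassersteinSubmanifold.geodRestrEDist (E '' S)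
    (E (WassersteinSubmanifold.expCurve θ η₁ t))
    (E (WassersteinSubmanifold.expCurve θ η₂ t))).toReal with hf
  have hf0 : f 0 = 0 := by
    have h0 := (key 0 (by simp)).2
    exact le_antisymm (by simpa [hf] using h0) ENNReal.toReal_nonneg
  rw [hasDerivWithinAt_iff_isLittleO]
  have hO : (fun t => f t - f 0 - (t - 0) • lpNorm (B θ (η₁ - η₂)) 2 (E θ))
      =O[𝓝[Icc 0 1] 0] fun t : ℝ => t ^ 2 := by
    refine Asymptotics.IsBigO.of_bound (C * (‖η₁‖ + ‖η₂‖) ^ 2) ?_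
    filter_upwards [self_mem_nhdsWithin] with t ht
    rw [hf0, sub_zero, sub_zero, smul_eq_mul, Real.norm_eq_abs, Real.norm_of_nonneg (sq_nonneg t)]
    refine (key t ht).2.trans_eq ?_
    ring
  refine hO.trans_isLittleO ?_
  have : (fun t : ℝ => t ^ 2) =o[𝓝 0] fun t : ℝ => t := by
    simpa using Asymptotics.isLittleO_pow_pow (𝕜 := ℝ) one_lt_two
  simpa using this.mono nhdsWithin_le_nhds
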